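/- Let $X=\{(x_i,i):1\le i\le n\}$, where $(x_1,\dots,x_n)$ is a permutation of $[n]=\{1,\dots,n\}$. Definitions. A pair of points has sign $\boxslash$ if one of them is strictly above and to the right of the other, and sign $\boxbslash$ if one is strictly above and to the left of the other. Rectangles are axis-parallel, and the rectangle of a pair is the one having the two points as opposite corners. Let $s\in\{\boxslash,\boxbslash\}$. * A set $Y\subseteq[n]^2$ is $s$-satisfied if for every pair $a,b\in Y$ of sign $s$ the closed rectangle of $a,b$ contains a point of $Y\setminus\{a,b\}$. $\mathsf{OPT}^{S}_s(X)$ is the minimum size of an $s$-satisfied $Y$ with $X\subseteq Y\subseteq[n]^2$, and $\mathsf{OPT}^{sS}(X)=\max_s\mathsf{OPT}^S_s(X)$. * $\mathrm{Greedy}_s$ sweeps $X$ by increasing $y$-coordinate; at height $i$ it adds $p=(x_i,i)$ and, for every previously obtained point $q$ such that $p,q$ has sign $s$ and the closed rectangle of $p,q$ contains no other obtained point, the point $(q.x,i)$. $\mathrm{SignedGreedy}(X)$ is the size of the union of the outputs of $\mathrm{Greedy}_{\boxslash}$ and $\mathrm{Greedy}_{\boxbslash}$. * Signed rectangulation. Let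 $M=\{(i,0),(i,n+1),(0,i),(n+1,i):i\in[n]\}$ be the set of margin points. A state consists of a finite set $P\subseteq [n]^2\cup M$ and a set $L$ of horizontal and vertical segments with endpoints in $P$. An elbow at $q$ is formed by a vertical and a horizontal segment with common endpoint $q$; it has sign $+$ if the two go up and right, or down and left, from $q$, and sign $-$ if they go up and left, or down and right. For $e\in\{+,-\}$, a state is $e$-valid if each segment of $L$ contains exactly two points of $P$, namely its endpoints; segments meet only at endpoints; and each point of $P\cap[n]^2$ is contained in at least two segments of $L$ and, if in exactly two, these do not form an elbow of the sign opposite to $e$. The initial state is $P_0=X\cup M$, with $L_0$ consisting of the segments $[(x,0),(x,y)]$ and $[(x,y),(x,n+1)]$ for $(x,y)\in X$. An end state is an $e$-valid state with $P\supseteq P_0$ whose segments are all horizontal and cover $\{0,\dots,n+1\}\times[n]$. A flip $\langle a,b\rangle$, with $a,b\in[n]^2\cup M$ distinct and on a common horizontal or vertical line, adds $a,b$ to $P$ and $[a,b]$ to $L$ and cuts segments of $L$ that have $a$ or $b$ in their interior at that point; the resulting state must be $e$-valid. After each flip any set of segments may be removed from $L$, provided the state stays $e$-valid. $\mathsf{OPT}^R_e(X)$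 is the minimum number of flips that lead from the initial state to an end state, and $\mathsf{OPT}^{sR}(X)=\max\{\mathsf{OPT}^R_+(X),\mathsf{OPT}^R_-(X)\}$. * An unsatisfied rectangle in $X$ is (the rectangle of) a pair $a,b\in X$ of distinct points whose closed rectangle contains no point of $X\setminus\{a,b\}$. Two such rectangles are independent if no corner of one is in the interior of the other. Let $\mathcal I(X)$ be a largest set of pairwise independent unsatisfied rectangles in $X$, let $\mathcal I_s(X)$ be a largest such set consisting of rectangles of pairs of sign $s$, and let $\mathsf{MIR}(X)=\frac12|\mathcal I(X)|+|X|$. * A manhattan path between $a$ and $b$ with respect to $Y$ is a sequence of distinct points of $Y$ from $a$ to $b$ in which consecutive points lie on a common horizontal or vertical line and both the $x$- and the $y$-coordinates are monotone. $\mathsf{OPT}^M(X)$ is the minimum size of a finite set $Y\supseteq X$ in the plane with a manhattan path with respect to $Y$ between any two points of $X$; $\mathsf{OPT}^M_s(X)$ is the same with paths required only for pairs of points of $X$ of sign $s$. Theorem. All these optimization problems have solutions, and there is an absolute constant $C>0$ such that for every $n$ and every permutation point set $X$ of size $n$, any two $A,B$ of the five quantities $$\mathrm{SignedGreedy}(X),\quad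 \mathsf{OPT}^{sS}(X),\quad \mathsf{OPT}^{sR}(X),\quad \mathsf{MIR}(X),\quad \mathsf{OPT}^{M}(X)$$ satisfy $A\le C\cdot B$. Moreover, for every permutation point set $X$, $$\mathsf{OPT}^M_{\boxslash}(X)\ge|X|+|\mathcal I_{\boxslash}(X)|,\qquad \mathsf{OPT}^M_{\boxbslash}(X)\ge|X|+|\mathcal I_{\boxbslash}(X)|,\qquad \mathsf{OPT}^M(X)\ge\mathsf{MIR}(X).$$ -/

import Mathlib

/-! ### Point sets, signs, rectangles -/

/-- Lattice points `(x, y)`. -/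
abbrev Pt := ℕ × ℕ

/-- The two signs. For pairs of points, `plus` means that one point is above and to the right of
the other, `minus` that one is above and to the left of the other. -/
inductive Sgn where
  | plus
  | minus

/-- The opposite sign. -/
def Sgn.opp : Sgn → Sgn
  | .plus => .minus
  | .minus => .plus

/-- `a` is strictly to the left of `b`; it is strictly below `b` for the sign `plus`, and strictly
above `b` for the sign `minus`. -/
def Oriented {α : Type*} [LT α] (s : Sgn) (a b : α × α) : Prop :=
  a.1 < b.1 ∧ match s with
    | .plus => a.2 < b.2
    | .minus => b.2 < a.2

/-- `c` lies in the closed axis-parallel rectangle with opposite corners `a` and `b`. -/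
def InRect (a b c : Pt) : Prop :=
  c.1 ∈ Set.uIcc a.1 b.1 ∧ c.2 ∈ Set.uIcc a.2 b.2

/-- The permutation point set `{(x_i, i) : 1 ≤ i ≤ n}`, for the permutation with
`x_(i+1) = σ i + 1` (indices of `Fin n` start at `0`). -/
def pointSet {n : ℕ} (σ : Equiv.Perm (Fin n)) : Finset Pt :=
  Finset.univ.image fun i : Fin n => ((σ i : ℕ) + 1, (i : ℕ) + 1)

/-- The grid `[n] × [n]`. -/
def grid (n : ℕ) : Finset Pt :=
  Finset.Icc 1 n ×ˢ Finset.Icc 1 n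

/-! ### Signed Satisfied Superset -/

/-- `Y` is `s`-satisfied. -/
def SignedSatisfied (s : Sgn) (Y : Finset Pt) : Prop :=
  ∀ a ∈ Y, ∀ b ∈ Y, Oriented s a b → ∃ c ∈ Y, c ≠ a ∧ c ≠ b ∧ InRect a b c

/-- The sizes of the solutions of the `s`-Satisfied Superset problem. -/
def satCosts {n : ℕ} (s : Sgn) (σ : Equiv.Perm (Fin n)) : Set ℕ :=
  {k | ∃ Y : Finset Pt, pointSet σ ⊆ Y ∧ Y ⊆ grid n ∧ SignedSatisfied s Y ∧ Y.card = k}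

/-- The optimum of the `s`-Satisfied Superset problem. -/
noncomputable def optSat {n : ℕ} (s : Sgn) (σ : Equiv.Perm (Fin n)) : ℕ :=
  sInf (satCosts s σ)

/-- The Signed Satisfied Superset optimum. -/
noncomputable def optSignedSat {n : ℕ} (σ : Equiv.Perm (Fin n)) : ℕ :=
  max (optSat .plus σ) (optSat .minus σ)

/-! ### SignedGreedy -/

open scoped Classical in
/-- The output of the `s`-Greedy sweep on `X` after the rows `1, …, i`. When the sweep reaches a row
it takes the points `p` of `X` in that row, and for every earlier point `q` of the output such that
`p` and `q` span a rectangle of sign `s` containing no other point of the output, it adds the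
corner of this rectangle that lies above or below `q` in the row of `p`. (These are the points that
must be added to the row to make the set `s`-satisfied again.) -/
noncomputable def greedyRows (s : Sgn) (X : Finset Pt) : ℕ → Finset Pt
  | 0 => ∅
  | i + 1 =>
    let Y := greedyRows s X i
    let row := X.filter fun p => p.2 = i + 1
    Y ∪ row ∪ row.biUnion fun p =>
      (Y.filter fun q => (Oriented s p q ∨ Oriented s q p) ∧
        ∀ c ∈ Y, c ≠ q → ¬ InRect p q c).image fun q => (q.1, p.2)

/-- The output of the `s`-Greedy algorithm. -/
noncomputable def greedy {n : ℕ} (s : Sgn) (σ : Equiv.Perm (Fin n)) : Finset Pt :=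
  greedyRows s (pointSet σ) n

/-- The size of the output of SignedGreedy, the union of the outputs of the two signed greedy
algorithms. -/
noncomputable def signedGreedy {n : ℕ} (σ : Equiv.Perm (Fin n)) : ℕ :=
  (greedy .plus σ ∪ greedy .minus σ).card

/-! ### Signed Rectangulation -/

/-- A segment, given by its two endpoints; the left (for a horizontal segment) or lower (for a
vertical segment) endpoint comes first. -/
abbrev Seg := Pt × Pt

/-- Horizontal segments. -/
def Seg.IsHor (s : Seg) : Prop := s.1.2 = s.2.2 ∧ s.1.1 < s.2.1

/-- Vertical segments. -/
def Seg.IsVert (s : Seg) : Prop := s.1.1 = s.2.1 ∧ s.1.2 < s.2.2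

/-- The lattice point `p` lies on the segment `s`. -/
def Seg.Contains (s : Seg) (p : Pt) : Prop :=
  s.1.1 ≤ p.1 ∧ p.1 ≤ s.2.1 ∧ s.1.2 ≤ p.2 ∧ p.2 ≤ s.2.2

/-- `p` is an endpoint of `s`. -/
def Seg.IsEnd (s : Seg) (p : Pt) : Prop := p = s.1 ∨ p = s.2

/-- `p` lies on the segment `s` and is not an endpoint of it. -/
def Seg.InInterior (s : Seg) (p : Pt) : Prop := s.Contains p ∧ ¬ s.IsEnd p

/-- `{0, …, n+1}²` without its four corner points. -/
def board (n : ℕ) : Finset Pt :=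
  (Finset.range (n + 2) ×ˢ Finset.range (n + 2)) \
    {(0, 0), (0, n + 1), (n + 1, 0), (n + 1, n + 1)}

/-- The margin points. -/
def margin (n : ℕ) : Finset Pt :=
  (Finset.Icc 1 n).biUnion fun i => {(i, 0), (i, n + 1), (0, i), (n + 1, i)}

/-- A set of points together with a set of segments. -/
structure RState where
  P : Finset Pt
  L : Finset Seg

/-- The vertical segment `v` and the horizontal segment `h` form an elbow of sign `s` at `q`.
For `plus`: `v` goes up and `h` goes right from `q`, or `v` goes down and `h` goes left.
For `minus`: `v` goes up and `h` goes left from `q`, or `v` goes down and `h` goes right. -/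
def FormsElbow (s : Sgn) (q : Pt) (v h : Seg) : Prop :=
  v.IsVert ∧ h.IsHor ∧ match s with
    | .plus => (v.1 = q ∧ h.1 = q) ∨ (v.2 = q ∧ h.2 = q)
    | .minus => (v.1 = q ∧ h.2 = q) ∨ (v.2 = q ∧ h.1 = q)

open scoped Classical in
/-- The segments of the state that contain `q`. -/
noncomputable def RState.at (S : RState) (q : Pt) : Finset Seg :=
  S.L.filter fun s => s.Contains q

/-- Every non-margin point of the state is contained in at least two segments, and if it is
contained in exactly two, then these do not form an elbow of sign `s`. -/
def RState.ElbowFree (s : Sgn) (n : ℕ) (S : RState) : Prop :=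
  ∀ q ∈ S.P, q ∈ grid n → 2 ≤ (S.at q).card ∧
    ((S.at q).card = 2 → ∀ v ∈ S.at q, ∀ h ∈ S.at q, ¬ FormsElbow s q v h)

/-- Valid states of the Rectangulation problem of size `n` in which the elbows of sign `s` are
allowed and those of the opposite sign are forbidden. For axis-parallel segments with lattice
endpoints that satisfy `only_ends`, two distinct segments can only meet in lattice points, so that
`no_crossing` excludes all intersections other than at endpoints. -/
structure RState.Valid (s : Sgn) (n : ℕ) (S : RState) : Prop where
  points : S.P ⊆ board n
  segments : ∀ t ∈ S.L, (t.IsHor ∨ t.IsVert) ∧ t.1 ∈ S.P ∧ t.2 ∈ S.P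
  only_ends : ∀ t ∈ S.L, ∀ p ∈ S.P, t.Contains p → t.IsEnd p
  no_crossing : ∀ t ∈ S.L, ∀ u ∈ S.L, t ≠ u → ∀ p, t.Contains p → u.Contains p →
    t.IsEnd p ∧ u.IsEnd p
  elbow_free : S.ElbowFree s.opp n

/-- The initial state: the points of `X` and the margin points, with a full vertical line through
every point of `X`. -/
def initialState {n : ℕ} (σ : Equiv.Perm (Fin n)) : RState where
  P := pointSet σ ∪ margin n
  L := (pointSet σ).biUnion fun p => {((p.1, 0), p), (p, (p.1, n + 1))}

/-- End states: valid states whose segments are all horizontal and cover all of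
`{0, …, n+1} × [n]`. -/
structure IsEndState {n : ℕ} (s : Sgn) (σ : Equiv.Perm (Fin n)) (S : RState) : Prop where
  valid : S.Valid s n
  points : pointSet σ ∪ margin n ⊆ S.P
  horizontal : ∀ t ∈ S.L, t.IsHor
  cover : ∀ x ∈ Finset.range (n + 2), ∀ y ∈ Finset.Icc 1 n, ∃ t ∈ S.L, t.Contains (x, y)

open scoped Classical in
/-- The two parts into which a segment is cut at an interior point `p`; no parts if `p` is not in
the interior of the segment. -/
noncomputable def Seg.cut (p : Pt) (t : Seg) : Finset Seg :=
  if t.InInterior p then {(t.1, p), (p, t.2)} else ∅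

open scoped Classical in
/-- The state after the flip `⟨a, b⟩`, before removal of segments: the segment with endpoints `a`
and `b` is added, and segments having `a` or `b` in their interior are cut there. -/
noncomputable def RState.flip (S : RState) (a b : Pt) : RState where
  P := S.P ∪ {a, b}
  L := insert (a, b) ((S.L.filter fun t => ¬ t.InInterior a ∧ ¬ t.InInterior b) ∪
    S.L.biUnion (Seg.cut a) ∪ S.L.biUnion (Seg.cut b))

/-- One valid flip `⟨a, b⟩`, followed by the removal of any number of segments. (The order of `a`
and `b` is the one fixed for the endpoints of a segment.) -/
def Step (s : Sgn) (n : ℕ) (S T : RState) : Prop :=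
  ∃ a ∈ board n, ∃ b ∈ board n, (Seg.IsHor (a, b) ∨ Seg.IsVert (a, b)) ∧
    (S.flip a b).Valid s n ∧ T.P = (S.flip a b).P ∧ T.L ⊆ (S.flip a b).L ∧ T.Valid s n

/-- `FlipsTo s n S k T`: the state `S` can be transformed into `T` by `k` valid flips. -/
inductive FlipsTo (s : Sgn) (n : ℕ) (S : RState) : ℕ → RState → Prop
  | refl : FlipsTo s n S 0 S
  | step {k : ℕ} {T U : RState} : FlipsTo s n S k T → Step s n T U → FlipsTo s n S (k + 1) U

/-- The numbers of flips of the solutions of the `s`-Rectangulation problem (elbows of sign `s`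
allowed). -/
def rectCosts {n : ℕ} (s : Sgn) (σ : Equiv.Perm (Fin n)) : Set ℕ :=
  {k | ∃ T, FlipsTo s n (initialState σ) k T ∧ IsEndState s σ T}

/-- The optimum of the `s`-Rectangulation problem. -/
noncomputable def optRect {n : ℕ} (s : Sgn) (σ : Equiv.Perm (Fin n)) : ℕ :=
  sInf (rectCosts s σ)

/-- The Signed Rectangulation optimum. -/
noncomputable def optSignedRect {n : ℕ} (σ : Equiv.Perm (Fin n)) : ℕ :=
  max (optRect .plus σ) (optRect .minus σ)

/-! ### The independent rectangle bound -/

/-- `(a, b)` is an unsatisfied rectangle in `X`, where `a` is the corner on the left (so that each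
unordered pair of points is considered once). -/
def IsUnsatRect (X : Finset Pt) (r : Pt × Pt) : Prop :=
  r.1 ∈ X ∧ r.2 ∈ X ∧ r.1.1 < r.2.1 ∧ r.1.2 ≠ r.2.2 ∧
    ∀ c ∈ X, c ≠ r.1 → c ≠ r.2 → ¬ InRect r.1 r.2 c

/-- The four corners of a rectangle. -/
def rectCorners (r : Pt × Pt) : Finset Pt :=
  {r.1, r.2, (r.1.1, r.2.2), (r.2.1, r.1.2)}

/-- `c` is in the interior of the rectangle `r`. -/
def InRectInterior (r : Pt × Pt) (c : Pt) : Prop :=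
  min r.1.1 r.2.1 < c.1 ∧ c.1 < max r.1.1 r.2.1 ∧ min r.1.2 r.2.2 < c.2 ∧ c.2 < max r.1.2 r.2.2

/-- Independence of two rectangles. -/
def IndepRect (r t : Pt × Pt) : Prop :=
  (∀ c ∈ rectCorners r, ¬ InRectInterior t c) ∧ ∀ c ∈ rectCorners t, ¬ InRectInterior r c

/-- `I` is a set of pairwise independent unsatisfied rectangles in `X`. -/
def IsIndepSet (X : Finset Pt) (I : Finset (Pt × Pt)) : Prop :=
  (∀ r ∈ I, IsUnsatRect X r) ∧ (I : Set (Pt × Pt)).Pairwise IndepRect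

open scoped Classical in
/-- The largest size of a set of independent rectangles in `X`. -/
noncomputable def maxIndep (X : Finset Pt) : ℕ :=
  ((X ×ˢ X).powerset.filter fun I => IsIndepSet X I).sup Finset.card

open scoped Classical in
/-- The largest size of a set of independent rectangles of sign `s` in `X`. -/
noncomputable def maxIndepSigned (s : Sgn) (X : Finset Pt) : ℕ :=
  ((X ×ˢ X).powerset.filter fun I =>
    IsIndepSet X I ∧ ∀ r ∈ I, Oriented s r.1 r.2).sup Finset.card

/-- The independent rectangle bound. -/
noncomputable def MIR (X : Finset Pt) : ℝ :=
  (maxIndep X : ℝ) / 2 + (X.card : ℝ)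

/-! ### Small Manhattan Network -/

/-- The list `l` is a manhattan path between `x` and `y` with respect to `B`. -/
structure IsManhattanPath (B : Finset (ℝ × ℝ)) (x y : ℝ × ℝ) (l : List (ℝ × ℝ)) : Prop where
  head : l.head? = some x
  last : l.getLast? = some y
  mem : ∀ p ∈ l, p ∈ B
  nodup : l.Nodup
  aligned : l.IsChain fun p q => p.1 = q.1 ∨ p.2 = q.2
  monotone_fst : (l.map Prod.fst).Pairwise (· ≤ ·) ∨ (l.map Prod.fst).Pairwise (· ≥ ·)
  monotone_snd : (l.map Prod.snd).Pairwise (· ≤ ·) ∨ (l.map Prod.snd).Pairwise (· ≥ ·)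

/-- The permutation point set as a set of points of the real plane. -/
noncomputable def realPointSet {n : ℕ} (σ : Equiv.Perm (Fin n)) : Finset (ℝ × ℝ) :=
  (pointSet σ).image fun p => ((p.1 : ℝ), (p.2 : ℝ))

/-- The sizes of the solutions of Small Manhattan Network; added points may lie anywhere in the
plane. -/
def manhattanCosts {n : ℕ} (σ : Equiv.Perm (Fin n)) : Set ℕ :=
  {k | ∃ Y : Finset (ℝ × ℝ), realPointSet σ ⊆ Y ∧
    (∀ a ∈ realPointSet σ, ∀ b ∈ realPointSet σ, ∃ l, IsManhattanPath Y a b l) ∧ Y.card = k}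

/-- The same with manhattan paths required only between the pairs of input points of sign `s`. -/
def signedManhattanCosts {n : ℕ} (s : Sgn) (σ : Equiv.Perm (Fin n)) : Set ℕ :=
  {k | ∃ Y : Finset (ℝ × ℝ), realPointSet σ ⊆ Y ∧
    (∀ a ∈ realPointSet σ, ∀ b ∈ realPointSet σ, Oriented s a b →
      ∃ l, IsManhattanPath Y a b l) ∧ Y.card = k}

/-- The Small Manhattan Network optimum. -/
noncomputable def optManhattan {n : ℕ} (σ : Equiv.Perm (Fin n)) : ℕ :=
  sInf (manhattanCosts σ)

/-- The signed manhattan optima. -/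
noncomputable def optSignedManhattan {n : ℕ} (s : Sgn) (σ : Equiv.Perm (Fin n)) : ℕ :=
  sInf (signedManhattanCosts s σ)

/-- The five quantities that are compared. -/
noncomputable def quantities {n : ℕ} (σ : Equiv.Perm (Fin n)) : Set ℝ :=
  {(signedGreedy σ : ℝ), (optSignedSat σ : ℝ), (optSignedRect σ : ℝ), MIR (pointSet σ),
    (optManhattan σ : ℝ)}

/-!
All five quantities are compared with the independent rectangle bound. The signed abscissa
`Sgn.coord`, which reflects the plane for the sign `minus`, turns the pairs of either sign into pairs
of a lower-left and an upper-right point, so that most arguments treat both signs at once.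

*Lower bound.* In a manhattan network for the pairs of sign `s`, every rectangle of an independent set
of sign `s` can be charged to a pair of horizontal neighbours of the network. Independent unsatisfied
rectangles of the same sign that overlap cross each other like a plus sign. Hence each rectangle `r`
has a vertical strip outside all overlapping rectangles that are no wider than `r`
(`exists_free_strip`), and the path between its corners crosses this strip along a pair that no
such rectangle contains. The charging is injective and misses the leftmost point of each row, which
gives `card_add_card_le_of_isIndepSet`. Satisfied sets contain staircase paths
(`SignedSatisfied.mPath`), so the bound applies to them as well.

*Upper bound.* The output of the signed greedy sweep is satisfied (`signedSatisfied_greedy`). Each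
point that it adds is a corner of the rectangle of the input points in its column and its row, and
`no_greedy_point` shows that these rectangles are unsatisfied and independent. So the output has at
most `|X| + maxIndepSigned s X` points (`card_greedy_le`). The union of the two signed outputs is a
manhattan network.

*Rectangulations.* If elbows of sign `e` are allowed, then in every valid state staircase paths of
the opposite sign can be continued at all grid points. For a pair of input points of that sign, the
staircase paths from the lower point pass the upper one on one side in the initial state and on the
other side in an end state. A flip state in which both happen contains a staircase path between the two
points, by planarity (`RState.Valid.reach_of_passes`), so the points of an end state form a signed
manhattan network. Conversely, let `Y` be a satisfied superset. After `Y` has been placed on the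
vertical lines, the horizontal segments between neighbours in `Y` are added one by one, and a vertical
segment is removed once no staircase path needs it. The process does not get stuck
(`exists_addable`): a horizontal segment for whose sake a longest remaining vertical segment is kept
could only be crossed by a longer one.
-/

/-! ### Signed coordinates -/

/-- The abscissa, reflected for the sign `minus`. In these coordinates a pair of either sign
consists of a lower-left and an upper-right point. -/
def Sgn.coord (s : Sgn) (x : ℕ) : ℤ :=
  match s with
  | .plus => x
  | .minus => -x

lemma Sgn.coord_inj {s : Sgn} {x y : ℕ} : s.coord x = s.coord y ↔ x = y := by
  cases s <;> simp [Sgn.coord]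

/-- In the signed coordinates, `a` is strictly below and to the left of `b`. -/
def Below (s : Sgn) (a b : Pt) : Prop :=
  s.coord a.1 < s.coord b.1 ∧ a.2 < b.2

lemma oriented_or_iff {s : Sgn} {a b : Pt} :
    (Oriented s a b ∨ Oriented s b a) ↔ (Below s a b ∨ Below s b a) := by
  cases s <;> simp only [Oriented, Below, Sgn.coord] <;> omega

lemma inRect_iff {s : Sgn} {a b c : Pt} (h₁ : s.coord a.1 ≤ s.coord b.1) (h₂ : a.2 ≤ b.2) :
    InRect a b c ↔ s.coord a.1 ≤ s.coord c.1 ∧ s.coord c.1 ≤ s.coord b.1 ∧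
      a.2 ≤ c.2 ∧ c.2 ≤ b.2 := by
  cases s <;> simp only [InRect, Sgn.coord, Set.mem_uIcc] at * <;> omega

lemma inRect_comm {a b c : Pt} : InRect a b c ↔ InRect b a c := by
  simp only [InRect, Set.uIcc_comm]

lemma signedSatisfied_iff {s : Sgn} {Y : Finset Pt} :
    SignedSatisfied s Y ↔ ∀ a ∈ Y, ∀ b ∈ Y, Below s a b → ∃ c ∈ Y, c ≠ a ∧ c ≠ b ∧
      s.coord a.1 ≤ s.coord c.1 ∧ s.coord c.1 ≤ s.coord b.1 ∧ a.2 ≤ c.2 ∧ c.2 ≤ b.2 := by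
  constructor
  · intro h a ha b hb hab
    rcases oriented_or_iff.2 (Or.inl hab) with h' | h'
    · obtain ⟨c, hc, h1, h2, h3⟩ := h a ha b hb h'
      exact ⟨c, hc, h1, h2, (inRect_iff hab.1.le hab.2.le).1 h3⟩
    · obtain ⟨c, hc, h1, h2, h3⟩ := h b hb a ha h'
      exact ⟨c, hc, h2, h1, (inRect_iff hab.1.le hab.2.le).1 (inRect_comm.1 h3)⟩
  · intro h a ha b hb hab
    rcases oriented_or_iff.1 (Or.inl hab) with h' | h'
    · obtain ⟨c, hc, h1, h2, h3⟩ := h a ha b hb h'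
      exact ⟨c, hc, h1, h2, (inRect_iff h'.1.le h'.2.le).2 h3⟩
    · obtain ⟨c, hc, h1, h2, h3⟩ := h b hb a ha h'
      exact ⟨c, hc, h2, h1, inRect_comm.1 ((inRect_iff h'.1.le h'.2.le).2 h3)⟩

/-! ### Monotone lattice paths -/

/-- `b` is straight above `a`, or it is horizontally displaced from `a` in the direction in which the
signed abscissa increases. -/
def Forward (s : Sgn) (a b : Pt) : Prop :=
  (a.1 = b.1 ∧ a.2 < b.2) ∨ (s.coord a.1 < s.coord b.1 ∧ a.2 = b.2)

/-- One step, inside the point set `Y`, of a staircase path. -/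
def MStep (s : Sgn) (Y : Finset Pt) (a b : Pt) : Prop :=
  a ∈ Y ∧ b ∈ Y ∧ Forward s a b

lemma Forward.bounds {s : Sgn} {a b : Pt} (h : Forward s a b) :
    s.coord a.1 ≤ s.coord b.1 ∧ a.2 ≤ b.2 := by
  rcases h with ⟨h1, h2⟩ | ⟨h1, h2⟩
  · exact ⟨by rw [h1], h2.le⟩
  · exact ⟨h1.le, h2.le⟩

lemma MStep.bounds {s : Sgn} {Y : Finset Pt} {a b : Pt} (h : MStep s Y a b) :
    s.coord a.1 ≤ s.coord b.1 ∧ a.2 ≤ b.2 := h.2.2.bounds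

/-- Staircase paths in `Y`. -/
abbrev MPath (s : Sgn) (Y : Finset Pt) : Pt → Pt → Prop :=
  Relation.ReflTransGen (MStep s Y)

lemma MPath.bounds {s : Sgn} {Y : Finset Pt} {a b : Pt} (h : MPath s Y a b) :
    s.coord a.1 ≤ s.coord b.1 ∧ a.2 ≤ b.2 := by
  induction h with
  | refl => exact ⟨le_rfl, le_rfl⟩
  | tail _ h ih => exact ⟨ih.1.trans h.bounds.1, ih.2.trans h.bounds.2⟩

/-- In a satisfied set the points of every pair of the right sign are joined by a staircase path:
subdivide at a further point of the rectangle and recurse. -/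
lemma SignedSatisfied.mPath {s : Sgn} {Y : Finset Pt} (hY : SignedSatisfied s Y) {a b : Pt}
    (ha : a ∈ Y) (hb : b ∈ Y) (h₁ : s.coord a.1 ≤ s.coord b.1) (h₂ : a.2 ≤ b.2) :
    MPath s Y a b := by
  rw [signedSatisfied_iff] at hY
  obtain ⟨m, hm⟩ : ∃ m : ℕ, (s.coord b.1 - s.coord a.1) + ((b.2 : ℤ) - a.2) = m :=
    ⟨_, (Int.toNat_of_nonneg (by omega)).symm⟩
  induction m using Nat.strong_induction_on generalizing a b with
  | _ m ih =>
    by_cases e1 : s.coord a.1 = s.coord b.1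
    · by_cases e2 : a.2 = b.2
      · rw [Prod.ext (Sgn.coord_inj.1 e1) e2]
      · exact .single ⟨ha, hb, .inl ⟨Sgn.coord_inj.1 e1, by omega⟩⟩
    · by_cases e2 : a.2 = b.2
      · exact .single ⟨ha, hb, .inr ⟨by omega, e2⟩⟩
      · obtain ⟨c, hc, hca, hcb, k1, k2, k3, k4⟩ := hY a ha b hb ⟨by omega, by omega⟩
        have p1 : ¬ (s.coord c.1 = s.coord a.1 ∧ c.2 = a.2) := fun h =>
          hca (Prod.ext (Sgn.coord_inj.1 h.1) h.2)
        have p2 : ¬ (s.coord c.1 = s.coord b.1 ∧ c.2 = b.2) := fun h =>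
          hcb (Prod.ext (Sgn.coord_inj.1 h.1) h.2)
        exact (ih _ (by omega) ha hc k1 k3 (Int.toNat_of_nonneg (by omega)).symm).trans
          (ih _ (by omega) hc hb k2 k4 (Int.toNat_of_nonneg (by omega)).symm)

/-! ### Manhattan paths -/

/-- The lattice point `p` as a point of the plane. -/
def toReal (p : Pt) : ℝ × ℝ := (p.1, p.2)

lemma toReal_injective : Function.Injective toReal := by
  intro p q h
  simp only [toReal, Prod.mk.injEq, Nat.cast_inj] at h
  exact Prod.ext h.1 h.2

lemma realPointSet_eq {n : ℕ} (σ : Equiv.Perm (Fin n)) :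
    realPointSet σ = (pointSet σ).image toReal := rfl

lemma IsManhattanPath.reverse {B : Finset (ℝ × ℝ)} {x y : ℝ × ℝ} {l : List (ℝ × ℝ)}
    (h : IsManhattanPath B x y l) : IsManhattanPath B y x l.reverse where
  head := by rw [List.head?_reverse]; exact h.last
  last := by rw [List.getLast?_reverse]; exact h.head
  mem p hp := h.mem p (List.mem_reverse.1 hp)
  nodup := List.nodup_reverse.2 h.nodup
  aligned := by
    rw [List.isChain_reverse]
    refine h.aligned.imp ?_
    rintro p q (h | h)
    · exact .inl h.symm
    · exact .inr h.symm
  monotone_fst := by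
    rw [List.map_reverse, List.pairwise_reverse, List.pairwise_reverse]
    exact h.monotone_fst.symm
  monotone_snd := by
    rw [List.map_reverse, List.pairwise_reverse, List.pairwise_reverse]
    exact h.monotone_snd.symm

lemma MPath.exists_isManhattanPath {s : Sgn} {Y : Finset Pt} {a b : Pt} (ha : a ∈ Y)
    (h : MPath s Y a b) : ∃ l, IsManhattanPath (Y.image toReal) (toReal a) (toReal b) l := by
  obtain ⟨l, hl, hlast⟩ := List.exists_isChain_cons_of_relationReflTransGen h
  have hp : (a :: l).Pairwise fun p q =>
      s.coord p.1 ≤ s.coord q.1 ∧ p.2 ≤ q.2 ∧ p ≠ q := by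
    let r : Pt → Pt → Prop := fun p q =>
      s.coord p.1 ≤ s.coord q.1 ∧ p.2 ≤ q.2 ∧ s.coord p.1 + p.2 < s.coord q.1 + q.2
    have : IsTrans Pt r := ⟨by intro p q t; simp only [r]; omega⟩
    refine ((List.isChain_iff_pairwise (R := r)).1 (hl.imp ?_)).imp ?_
    · intro p q hpq
      have := hpq.bounds
      refine ⟨this.1, this.2, ?_⟩
      rcases hpq.2.2 with ⟨h1, h2⟩ | ⟨h1, h2⟩
      · rw [h1]; omega
      · omega
    · rintro p q ⟨h1, h2, h3⟩
      exact ⟨h1, h2, by rintro rfl; omega⟩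
  refine ⟨(a :: l).map toReal, ⟨rfl, ?_, ?_, ?_, ?_, ?_, ?_⟩⟩
  · rw [List.getLast?_map, List.getLast?_eq_getLast_of_ne_nil (List.cons_ne_nil _ _), hlast]
    rfl
  · intro p hp
    obtain ⟨q, hq, rfl⟩ := List.mem_map.1 hp
    refine Finset.mem_image_of_mem _ ?_
    clear hp hlast
    suffices ∀ (l : List Pt) (a : Pt), a ∈ Y → (a :: l).IsChain (MStep s Y) →
        ∀ q ∈ a :: l, q ∈ Y from this l a ha hl q hq
    intro l
    induction l with
    | nil => intro a ha _ q hq; simp only [List.mem_singleton] at hq; exact hq ▸ ha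
    | cons c l ih =>
      intro a ha hl q hq
      rw [List.isChain_cons_cons] at hl
      rcases List.mem_cons.1 hq with rfl | hq
      · exact ha
      · exact ih c hl.1.2.1 hl.2 q hq
  · exact List.Nodup.map toReal_injective (hp.imp fun h => h.2.2)
  · rw [List.isChain_map]
    refine hl.imp ?_
    rintro p q ⟨-, -, h | h⟩
    · exact .inl (by simp [toReal, h.1])
    · exact .inr (by simp [toReal, h.2])
  · rw [List.map_map, List.pairwise_map, List.pairwise_map]
    cases s
    · refine .inl (hp.imp fun h => ?_)
      have := h.1
      simpa [toReal, Sgn.coord] using this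
    · refine .inr (hp.imp fun h => ?_)
      have := h.1
      simpa [toReal, Sgn.coord] using this
  · rw [List.map_map, List.pairwise_map]
    exact .inl (hp.imp fun h => by simpa [toReal] using h.2.1)

/-- If `Y` contains staircase paths of sign `s` between all the pairs of sign `s` of points of `X`,
then it contains manhattan paths between these pairs. -/
lemma exists_isManhattanPath_of_oriented {s : Sgn} {X Y : Finset Pt} (hXY : X ⊆ Y)
    (h : ∀ a ∈ X, ∀ b ∈ X, Below s a b → MPath s Y a b) :
    ∀ a ∈ X, ∀ b ∈ X, Oriented s a b →
      ∃ l, IsManhattanPath (Y.image toReal) (toReal a) (toReal b) l := by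
  intro a ha b hb hab
  rcases oriented_or_iff.1 (.inl hab) with h' | h'
  · exact (h a ha b hb h').exists_isManhattanPath (hXY ha)
  · obtain ⟨l, hl⟩ := (h b hb a ha h').exists_isManhattanPath (hXY hb)
    exact ⟨_, hl.reverse⟩

lemma oriented_toReal {s : Sgn} {a b : Pt} :
    Oriented s (toReal a) (toReal b) ↔ Oriented s a b := by
  cases s <;> simp [Oriented, toReal]

lemma card_mem_signedManhattanCosts {n : ℕ} {s : Sgn} (σ : Equiv.Perm (Fin n)) {Y : Finset Pt}
    (hXY : pointSet σ ⊆ Y)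
    (h : ∀ a ∈ pointSet σ, ∀ b ∈ pointSet σ, Below s a b → MPath s Y a b) :
    Y.card ∈ signedManhattanCosts s σ := by
  refine ⟨Y.image toReal, Finset.image_subset_image hXY, ?_,
    Finset.card_image_of_injective _ toReal_injective⟩
  rw [realPointSet_eq]
  intro a' ha' b' hb' hab
  obtain ⟨a, ha, rfl⟩ := Finset.mem_image.1 ha'
  obtain ⟨b, hb, rfl⟩ := Finset.mem_image.1 hb'
  exact exists_isManhattanPath_of_oriented hXY h a ha b hb (oriented_toReal.1 hab)

/-! ### Permutation point sets -/

section PointSet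

variable {n : ℕ} {σ : Equiv.Perm (Fin n)}

lemma mem_pointSet {p : Pt} :
    p ∈ pointSet σ ↔ ∃ i : Fin n, (σ i : ℕ) + 1 = p.1 ∧ (i : ℕ) + 1 = p.2 := by
  simp [pointSet, Prod.ext_iff]

lemma card_pointSet : (pointSet σ).card = n := by
  rw [pointSet, Finset.card_image_of_injective, Finset.card_univ, Fintype.card_fin]
  intro i j h
  simp only [Prod.mk.injEq] at h
  exact Fin.ext (by omega)

lemma mem_grid {p : Pt} : p ∈ grid n ↔ (1 ≤ p.1 ∧ p.1 ≤ n) ∧ 1 ≤ p.2 ∧ p.2 ≤ n := by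
  simp [grid]

lemma pointSet_subset_grid : pointSet σ ⊆ grid n := by
  intro p hp
  obtain ⟨i, h1, h2⟩ := mem_pointSet.1 hp
  rw [mem_grid]
  omega

lemma pointSet_ext_fst {p q : Pt} (hp : p ∈ pointSet σ) (hq : q ∈ pointSet σ) (h : p.1 = q.1) :
    p = q := by
  obtain ⟨i, h1, h2⟩ := mem_pointSet.1 hp
  obtain ⟨j, h3, h4⟩ := mem_pointSet.1 hq
  have : σ i = σ j := Fin.ext (by omega)
  have := σ.injective this
  subst this
  exact Prod.ext h (by omega)

lemma pointSet_ext_snd {p q : Pt} (hp : p ∈ pointSet σ) (hq : q ∈ pointSet σ) (h : p.2 = q.2) :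
    p = q := by
  obtain ⟨i, h1, h2⟩ := mem_pointSet.1 hp
  obtain ⟨j, h3, h4⟩ := mem_pointSet.1 hq
  have : i = j := Fin.ext (by omega)
  subst this
  exact Prod.ext (by omega) h

variable (σ) in
lemma exists_mem_pointSet_snd {y : ℕ} (h1 : 1 ≤ y) (h2 : y ≤ n) : ∃ p ∈ pointSet σ, p.2 = y :=
  ⟨((σ ⟨y - 1, by omega⟩ : ℕ) + 1, y), mem_pointSet.2 ⟨⟨y - 1, by omega⟩, rfl, by simp; omega⟩, rfl⟩

variable (σ) in
lemma exists_mem_pointSet_fst {x : ℕ} (h1 : 1 ≤ x) (h2 : x ≤ n) : ∃ p ∈ pointSet σ, p.1 = x :=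
  ⟨(x, (σ.symm ⟨x - 1, by omega⟩ : ℕ) + 1),
    mem_pointSet.2 ⟨σ.symm ⟨x - 1, by omega⟩, by simp; omega, rfl⟩, rfl⟩

end PointSet

/-! ### Independent rectangles bound signed manhattan networks from below -/

/-- If the left side of `t` is strictly between the vertical sides of `r`, then `t` crosses `r`
from bottom to top. -/
lemma IsUnsatRect.cross_of_lt {X : Finset Pt} {s : Sgn} {r t : Pt × Pt}
    (hr : IsUnsatRect X r) (ht : IsUnsatRect X t)
    (hrs : Oriented s r.1 r.2) (hts : Oriented s t.1 t.2) (hind : IndepRect r t)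
    (hx₁ : r.1.1 < t.1.1) (hx₂ : t.1.1 < r.2.1)
    (hy₁ : min r.1.2 r.2.2 < max t.1.2 t.2.2) (hy₂ : min t.1.2 t.2.2 < max r.1.2 r.2.2) :
    t.2.1 ≤ r.2.1 ∧
      min t.1.2 t.2.2 ≤ min r.1.2 r.2.2 ∧ max r.1.2 r.2.2 ≤ max t.1.2 t.2.2 := by
  have e1 := hr.2.2.2.2 _ ht.1 (fun h => by rw [h] at hx₁; omega) (fun h => by rw [h] at hx₂; omega)
  have e2 := hind.2 (t.1.1, t.2.2) (by simp [rectCorners])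
  have e3 := hind.1 (r.2.1, r.1.2) (by simp [rectCorners])
  simp only [InRectInterior, InRect, Set.mem_uIcc] at e1 e2 e3
  clear hr ht hind
  cases s <;> simp only [Oriented] at hrs hts <;> omega

lemma IndepRect.symm {r t : Pt × Pt} (h : IndepRect r t) : IndepRect t r := ⟨h.2, h.1⟩

/-- Two independent unsatisfied rectangles of the same sign whose interiors overlap cross
each other like a plus sign. -/
lemma IsUnsatRect.cross {n : ℕ} {σ : Equiv.Perm (Fin n)} {s : Sgn} {r t : Pt × Pt}
    (hr : IsUnsatRect (pointSet σ) r) (ht : IsUnsatRect (pointSet σ) t)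
    (hrs : Oriented s r.1 r.2) (hts : Oriented s t.1 t.2) (hind : IndepRect r t)
    (hx₁ : r.1.1 < t.2.1) (hx₂ : t.1.1 < r.2.1)
    (hy₁ : min r.1.2 r.2.2 < max t.1.2 t.2.2) (hy₂ : min t.1.2 t.2.2 < max r.1.2 r.2.2) :
    (r.1.1 ≤ t.1.1 ∧ t.2.1 ≤ r.2.1 ∧
      min t.1.2 t.2.2 ≤ min r.1.2 r.2.2 ∧ max r.1.2 r.2.2 ≤ max t.1.2 t.2.2) ∨
    (t.1.1 ≤ r.1.1 ∧ r.2.1 ≤ t.2.1 ∧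
      min r.1.2 r.2.2 ≤ min t.1.2 t.2.2 ∧ max t.1.2 t.2.2 ≤ max r.1.2 r.2.2) := by
  rcases lt_trichotomy r.1.1 t.1.1 with h | h | h
  · exact .inl ⟨h.le, hr.cross_of_lt ht hrs hts hind h hx₂ hy₁ hy₂⟩
  · have hs := pointSet_ext_fst hr.1 ht.1 h
    rcases lt_trichotomy r.2.1 t.2.1 with h' | h' | h'
    · have e := ht.2.2.2.2 _ hr.2.1 (fun h => by rw [h] at hx₂; omega)
        (fun h => by rw [h] at h'; omega)
      simp only [InRect, Set.mem_uIcc] at e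
      have hs' := congrArg Prod.snd hs
      clear hr ht hind
      cases s <;> simp only [Oriented] at hrs hts <;> omega
    · rw [hs, pointSet_ext_fst hr.2.1 ht.2.1 h']
      simp
    · have e := hr.2.2.2.2 _ ht.2.1 (fun h => by rw [h] at hx₁; omega)
        (fun h => by rw [h] at h'; omega)
      simp only [InRect, Set.mem_uIcc] at e
      have hs' := congrArg Prod.snd hs
      clear hr ht hind
      cases s <;> simp only [Oriented] at hrs hts <;> omega
  · exact .inr ⟨h.le, ht.cross_of_lt hr hts hrs hind.symm h hx₁ hy₂ hy₁⟩

/-- Every rectangle `r` of an independent set of sign `s` has a vertical strip of unit width that is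
disjoint from the interior of every other rectangle of the set that is no wider than `r` and meets
`r` at heights in its interior. The strip adjoins the widest of those rectangles. -/
lemma exists_free_strip {n : ℕ} {σ : Equiv.Perm (Fin n)} {s : Sgn} {I : Finset (Pt × Pt)}
    (hI : IsIndepSet (pointSet σ) I) (hs : ∀ r ∈ I, Oriented s r.1 r.2) {r : Pt × Pt} (hr : r ∈ I) :
    ∃ k, r.1.1 ≤ k ∧ k < r.2.1 ∧ ∀ t ∈ I, t ≠ r → t.2.1 - t.1.1 ≤ r.2.1 - r.1.1 →
      min r.1.2 r.2.2 < max t.1.2 t.2.2 → min t.1.2 t.2.2 < max r.1.2 r.2.2 →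
      t.1.1 ≤ k → t.2.1 ≤ k := by
  classical
  let F := I.filter fun t => t ≠ r ∧ t.2.1 - t.1.1 ≤ r.2.1 - r.1.1 ∧
      min r.1.2 r.2.2 < max t.1.2 t.2.2 ∧ min t.1.2 t.2.2 < max r.1.2 r.2.2 ∧
      r.1.1 < t.2.1 ∧ t.1.1 < r.2.1
  have hrx := (hI.1 r hr).2.2.1
  rcases F.eq_empty_or_nonempty with hF | hF
  · refine ⟨r.1.1, le_rfl, hrx, fun t ht h1 h2 h3 h4 h5 => ?_⟩
    by_contra h6
    have : t ∈ F := Finset.mem_filter.2 ⟨ht, h1, h2, h3, h4, by omega, by omega⟩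
    simp [hF] at this
  obtain ⟨w, hw, hmax⟩ := F.exists_max_image (fun t => t.2.1 - t.1.1) hF
  have key : ∀ t ∈ F, (r.1.1 ≤ t.1.1 ∧ t.2.1 ≤ r.2.1 ∧
      min t.1.2 t.2.2 ≤ min r.1.2 r.2.2 ∧ max r.1.2 r.2.2 ≤ max t.1.2 t.2.2) ∧
      ¬ (r.1.1 = t.1.1 ∧ t.2.1 = r.2.1) := by
    intro t ht
    obtain ⟨ht, h1, h2, h3, h4, h5, h6⟩ := Finset.mem_filter.1 ht
    have hne : ¬ (r.1.1 = t.1.1 ∧ t.2.1 = r.2.1) := fun h => h1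
      (Prod.ext (pointSet_ext_fst (hI.1 t ht).1 (hI.1 r hr).1 h.1.symm)
        (pointSet_ext_fst (hI.1 t ht).2.1 (hI.1 r hr).2.1 h.2))
    have htx := (hI.1 t ht).2.2.1
    refine ⟨?_, hne⟩
    rcases (hI.1 r hr).cross (hI.1 t ht) (hs r hr) (hs t ht) (hI.2 hr ht h1.symm)
      h5 h6 h3 h4 with h | h
    · exact h
    · omega
  obtain ⟨⟨k1, k2, k3, k4⟩, k5⟩ := key w hw
  have hwI := (Finset.mem_filter.1 hw).1
  have hwx := (hI.1 w hwI).2.2.1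
  have hws := hs w hwI
  -- a second member of `F` through the strip next to `w` would be nested with `w`
  have aux : ∀ k, r.1.1 ≤ k → k < r.2.1 → (k = w.2.1 ∨ k + 1 = w.1.1) →
      ∀ t ∈ I, t ≠ r → t.2.1 - t.1.1 ≤ r.2.1 - r.1.1 →
      min r.1.2 r.2.2 < max t.1.2 t.2.2 → min t.1.2 t.2.2 < max r.1.2 r.2.2 →
      t.1.1 ≤ k → t.2.1 ≤ k := by
    intro k a1 a2 a3 t ht h1 h2 h3 h4 h5
    by_contra h6
    have htF : t ∈ F := Finset.mem_filter.2 ⟨ht, h1, h2, h3, h4, by omega, by omega⟩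
    obtain ⟨⟨t1, t2, t3, t4⟩, t5⟩ := key t htF
    have hm := hmax t htF
    have hts := hs t ht
    have hne : w ≠ t := by rintro rfl; omega
    have d1 : t.1.1 ≠ w.2.1 := by
      intro h
      have := congrArg Prod.snd (pointSet_ext_fst (hI.1 t ht).1 (hI.1 w hwI).2.1 h)
      cases s <;> simp only [Oriented] at hts hws <;> omega
    have d2 : t.2.1 ≠ w.1.1 := by
      intro h
      have := congrArg Prod.snd (pointSet_ext_fst (hI.1 t ht).2.1 (hI.1 w hwI).1 h)
      cases s <;> simp only [Oriented] at hts hws <;> omega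
    rcases (hI.1 w hwI).cross (hI.1 t ht) hws hts (hI.2 hwI ht hne)
      (by omega) (by omega) (by omega) (by omega) with h | h <;> omega
  by_cases hc : w.2.1 < r.2.1
  · exact ⟨w.2.1, by omega, hc, aux _ (by omega) hc (.inl rfl)⟩
  · exact ⟨w.1.1 - 1, by omega, by omega, aux _ (by omega) (by omega) (.inr (by omega))⟩

lemma List.IsChain.exists_crossing {α : Type*} {R : α → α → Prop} {P : α → Prop} {l : List α}
    (hl : l.IsChain R) {a b : α} (ha : l.head? = some a) (hb : l.getLast? = some b)
    (hPa : P a) (hPb : ¬ P b) : ∃ p ∈ l, ∃ q ∈ l, R p q ∧ P p ∧ ¬ P q := by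
  induction l generalizing a with
  | nil => simp at ha
  | cons c l ih =>
    obtain rfl : c = a := by simpa using ha
    cases l with
    | nil =>
      obtain rfl : c = b := by simpa using hb
      exact absurd hPa hPb
    | cons d l =>
      rw [List.isChain_cons_cons] at hl
      by_cases hd : P d
      · obtain ⟨p, hp, q, hq, h⟩ := ih hl.2 (a := d) rfl (by simpa using hb) hd
        exact ⟨p, List.mem_cons_of_mem _ hp, q, List.mem_cons_of_mem _ hq, h⟩
      · exact ⟨c, by simp, d, by simp, hl.1, hPa, hd⟩

lemma List.mem_uIcc_of_monotone {α : Type*} {f : α → ℝ} {l : List α} {a b p : α}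
    (hl : (l.map f).Pairwise (· ≤ ·) ∨ (l.map f).Pairwise (· ≥ ·))
    (ha : l.head? = some a) (hb : l.getLast? = some b) (hp : p ∈ l) :
    f p ∈ Set.uIcc (f a) (f b) := by
  have key : ∀ {R : ℝ → ℝ → Prop} [Std.Refl R], (l.map f).Pairwise R →
      R (f a) (f p) ∧ R (f p) (f b) := by
    intro R _ h
    constructor
    · cases l with
      | nil => simp at ha
      | cons c l =>
        obtain rfl : c = a := by simpa using ha
        rcases List.mem_cons.1 hp with rfl | hp
        · exact Std.Refl.refl _
        · exact List.rel_of_pairwise_cons h (List.mem_map_of_mem hp)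
    · rcases List.eq_nil_or_concat l with rfl | ⟨l, c, rfl⟩
      · simp at ha
      · obtain rfl : c = b := by simpa using hb
        rw [List.concat_eq_append, List.mem_append, List.mem_singleton] at hp
        rcases hp with hp | rfl
        · rw [List.concat_eq_append, List.map_append, List.pairwise_append] at h
          exact h.2.2 _ (List.mem_map_of_mem hp) _ (by simp)
        · exact Std.Refl.refl _
  rw [Set.mem_uIcc]
  rcases hl with h | h
  · exact .inl (key h)
  · have : Std.Refl (fun x y : ℝ => x ≥ y) := ⟨fun x => le_refl x⟩
    exact .inr (key h).symm

/-- A manhattan path across a vertical line that contains no point of `Y` crosses it between two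
points of `Y` that are neighbours on a horizontal line. -/
lemma IsManhattanPath.exists_gap {Y : Finset (ℝ × ℝ)} {a b : ℝ × ℝ} {l : List (ℝ × ℝ)}
    (h : IsManhattanPath Y a b l) {t : ℝ} (ht : ∀ z ∈ Y, z.1 ≠ t) (hat : a.1 < t) (htb : t < b.1) :
    ∃ p ∈ Y, ∃ q ∈ Y, p.2 = q.2 ∧ a.1 ≤ p.1 ∧ p.1 < t ∧ t < q.1 ∧ q.1 ≤ b.1 ∧
      q.2 ∈ Set.uIcc a.2 b.2 ∧ ∀ z ∈ Y, z.2 = q.2 → z.1 ≤ p.1 ∨ q.1 ≤ z.1 := by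
  classical
  obtain ⟨p, hp, q, hq, hpq, hpt, hqt⟩ := h.aligned.exists_crossing (P := fun z => z.1 < t)
    h.head h.last hat (not_lt.2 htb.le)
  have hqt' : t < q.1 := lt_of_le_of_ne (not_lt.1 hqt) (ht q (h.mem q hq)).symm
  have hrow : p.2 = q.2 := hpq.resolve_left (by intro h; linarith)
  have hp1 := List.mem_uIcc_of_monotone h.monotone_fst h.head h.last hp
  have hq1 := List.mem_uIcc_of_monotone h.monotone_fst h.head h.last hq
  have hq2 := List.mem_uIcc_of_monotone h.monotone_snd h.head h.last hq
  rw [Set.uIcc_of_le (by linarith)] at hp1 hq1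
  obtain ⟨p', hp', hpmax⟩ := (Y.filter fun z => z.2 = q.2 ∧ z.1 < t).exists_max_image Prod.fst
    ⟨p, Finset.mem_filter.2 ⟨h.mem p hp, hrow, hpt⟩⟩
  obtain ⟨q', hq', hqmin⟩ := (Y.filter fun z => z.2 = q.2 ∧ t < z.1).exists_min_image Prod.fst
    ⟨q, Finset.mem_filter.2 ⟨h.mem q hq, rfl, hqt'⟩⟩
  have h1 := hpmax p (Finset.mem_filter.2 ⟨h.mem p hp, hrow, hpt⟩)
  have h2 := hqmin q (Finset.mem_filter.2 ⟨h.mem q hq, rfl, hqt'⟩)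
  rw [Finset.mem_filter] at hp' hq'
  refine ⟨p', hp'.1, q', hq'.1, hp'.2.1.trans hq'.2.1.symm, hp1.1.trans h1, hp'.2.2, hq'.2.2,
    h2.trans hq1.2, by rw [hq'.2.1]; exact hq2, fun z hz hz2 => ?_⟩
  rw [hq'.2.1] at hz2
  rcases lt_or_gt_of_ne (ht z hz) with h | h
  · exact .inl (hpmax z (Finset.mem_filter.2 ⟨hz, hz2, h⟩))
  · exact .inr (hqmin z (Finset.mem_filter.2 ⟨hz, hz2, h⟩))

/-- Each rectangle of an independent set of sign `s` is charged to a pair of horizontal neighbours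
in the network, where the network crosses the free strip of the rectangle. The pairs are distinct,
and none of their right ends is the leftmost point of its row. -/
lemma card_add_card_le_of_isIndepSet {n : ℕ} {σ : Equiv.Perm (Fin n)} {s : Sgn}
    {I : Finset (Pt × Pt)} (hI : IsIndepSet (pointSet σ) I) (hs : ∀ r ∈ I, Oriented s r.1 r.2)
    {Y : Finset (ℝ × ℝ)} (hXY : realPointSet σ ⊆ Y)
    (hY : ∀ a ∈ realPointSet σ, ∀ b ∈ realPointSet σ, Oriented s a b →
      ∃ l, IsManhattanPath Y a b l) :
    (pointSet σ).card + I.card ≤ Y.card := by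
  classical
  rw [realPointSet_eq] at hXY hY
  have hgap : ∀ r ∈ I, ∃ q ∈ Y, ∃ p ∈ Y, ∃ t : ℝ, p.2 = q.2 ∧ (r.1.1 : ℝ) ≤ p.1 ∧ p.1 < t ∧
      t < q.1 ∧ q.1 ≤ (r.2.1 : ℝ) ∧ q.2 ∈ Set.uIcc (r.1.2 : ℝ) r.2.2 ∧
      (∀ z ∈ Y, z.2 = q.2 → z.1 ≤ p.1 ∨ q.1 ≤ z.1) ∧
      ∀ u ∈ I, u ≠ r → u.2.1 - u.1.1 ≤ r.2.1 - r.1.1 →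
        min r.1.2 r.2.2 < max u.1.2 u.2.2 → min u.1.2 u.2.2 < max r.1.2 r.2.2 →
        (u.1.1 : ℝ) < t → (u.2.1 : ℝ) ≤ t := by
    intro r hr
    obtain ⟨k, h1, h2, h3⟩ := exists_free_strip hI hs hr
    obtain ⟨t, ht, htY⟩ := (Set.Ioo_infinite (show (k : ℝ) < k + 1 by linarith)).exists_notMem_finset
      (Y.image Prod.fst)
    have h1' : (r.1.1 : ℝ) ≤ k := by exact_mod_cast h1
    have h2' : (k : ℝ) + 1 ≤ r.2.1 := by exact_mod_cast h2
    obtain ⟨l, hl⟩ := hY _ (Finset.mem_image_of_mem toReal (hI.1 r hr).1) _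
      (Finset.mem_image_of_mem toReal (hI.1 r hr).2.1) (oriented_toReal.2 (hs r hr))
    obtain ⟨p, hp, q, hq, e1, e2, e3, e4, e5, e6, e7⟩ := hl.exists_gap (t := t)
      (fun z hz h => htY (h ▸ Finset.mem_image_of_mem _ hz))
      (by simp only [toReal]; linarith [ht.1]) (by simp only [toReal]; linarith [ht.2])
    refine ⟨q, hq, p, hp, t, e1, e2, e3, e4, e5, e6, e7, fun u hu g1 g2 g3 g4 g5 => ?_⟩
    have : (u.1.1 : ℝ) < (k + 1 : ℕ) := by push_cast; linarith [ht.2]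
    have : u.1.1 ≤ k := Nat.lt_succ_iff.1 (by exact_mod_cast this)
    have : (u.2.1 : ℝ) ≤ k := by exact_mod_cast h3 u hu g1 g2 g3 g4 this
    linarith [ht.1]
  choose! q hqY p hpY t hrow hlp hpt htq hqr hqy hadj hfree using hgap
  have hinj : ∀ r ∈ I, ∀ u ∈ I, u ≠ r → u.2.1 - u.1.1 ≤ r.2.1 - r.1.1 → q r ≠ q u := by
    intro r hr u hu hne hw he
    have hpp : p u = p r ∨ (p u).1 ≤ (p r).1 := by
      rcases hadj r hr (p u) (hpY u hu) (by rw [hrow u hu, he]) with h | h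
      · exact .inr h
      · have := hpt u hu
        have := htq u hu
        rw [he] at h
        linarith
    have hple : (p u).1 ≤ (p r).1 := by
      rcases hpp with h | h
      · rw [h]
      · exact h
    have l1 : (u.1.1 : ℝ) < t r := by linarith [hlp u hu, hpt r hr]
    have l2 : t r < u.2.1 := by
      have := htq r hr
      rw [he] at this
      linarith [hqr u hu]
    have l3 : (r.1.1 : ℝ) < t r := by linarith [hlp r hr, hpt r hr]
    have l4 : t r < r.2.1 := by linarith [htq r hr, hqr r hr]
    have m1 : u.1.1 < r.2.1 := by exact_mod_cast l1.trans l4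
    have m2 : r.1.1 < u.2.1 := by exact_mod_cast l3.trans l2
    have y1 := hqy r hr
    have y2 := hqy u hu
    rw [he] at y1
    rw [Set.mem_uIcc] at y1 y2
    have c1 : min r.1.2 r.2.2 ≤ max u.1.2 u.2.2 := by
      rw [← Nat.cast_le (α := ℝ)]; push_cast
      rw [min_le_iff, le_max_iff, le_max_iff]
      rcases y1 with y1 | y1 <;> rcases y2 with y2 | y2
      · exact .inl (.inr (by linarith))
      · exact .inl (.inl (by linarith))
      · exact .inr (.inr (by linarith))
      · exact .inr (.inl (by linarith))
    have c2 : min u.1.2 u.2.2 ≤ max r.1.2 r.2.2 := by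
      rw [← Nat.cast_le (α := ℝ)]; push_cast
      rw [min_le_iff, le_max_iff, le_max_iff]
      rcases y1 with y1 | y1 <;> rcases y2 with y2 | y2
      · exact .inl (.inr (by linarith))
      · exact .inr (.inr (by linarith))
      · exact .inl (.inl (by linarith))
      · exact .inr (.inl (by linarith))
    have hrs := hs r hr
    have hus := hs u hu
    have d1 : r.1.2 ≠ u.2.2 := fun h => m2.ne
      (congrArg Prod.fst (pointSet_ext_snd (hI.1 r hr).1 (hI.1 u hu).2.1 h))
    have d2 : r.2.2 ≠ u.1.2 := fun h => m1.ne'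
      (congrArg Prod.fst (pointSet_ext_snd (hI.1 r hr).2.1 (hI.1 u hu).1 h))
    have hy : min r.1.2 r.2.2 < max u.1.2 u.2.2 ∧ min u.1.2 u.2.2 < max r.1.2 r.2.2 := by
      cases s <;> simp only [Oriented] at hrs hus <;> omega
    exact absurd (hfree r hr u hu hne hw hy.1 hy.2 l1) (not_le.2 l2)
  have hleft : ∀ x ∈ pointSet σ, ∃ m ∈ Y, m.2 = (x.2 : ℝ) ∧ ∀ z ∈ Y, z.2 = m.2 → m.1 ≤ z.1 := by
    intro x hx
    obtain ⟨m, hm, hmin⟩ := (Y.filter fun z => z.2 = (x.2 : ℝ)).exists_min_image Prod.fst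
      ⟨toReal x, Finset.mem_filter.2 ⟨hXY (Finset.mem_image_of_mem _ hx), rfl⟩⟩
    rw [Finset.mem_filter] at hm
    exact ⟨m, hm.1, hm.2, fun z hz h => hmin z (Finset.mem_filter.2 ⟨hz, h.trans hm.2⟩)⟩
  choose! m hmY hm2 hmin using hleft
  have hcard1 : (I.image q).card = I.card := by
    refine Finset.card_image_of_injOn fun r hr u hu he => ?_
    by_contra hne
    rcases le_total (u.2.1 - u.1.1) (r.2.1 - r.1.1) with h | h
    · exact hinj r hr u hu (fun h => hne h.symm) h he
    · exact hinj u hu r hr hne h he.symm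
  have hcard2 : ((pointSet σ).image m).card = (pointSet σ).card := by
    refine Finset.card_image_of_injOn fun x hx z hz he => ?_
    have h1 := hm2 x hx
    have h2 := hm2 z hz
    rw [he, h2] at h1
    exact pointSet_ext_snd hx hz (by exact_mod_cast h1.symm)
  have hdisj : Disjoint ((pointSet σ).image m) (I.image q) := by
    rw [Finset.disjoint_left]
    intro z hz hz'
    obtain ⟨x, hx, rfl⟩ := Finset.mem_image.1 hz
    obtain ⟨r, hr, he⟩ := Finset.mem_image.1 hz'
    have h1 := hmin x hx (p r) (hpY r hr) (by rw [hrow r hr, he])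
    have h2 := hpt r hr
    have h3 := htq r hr
    rw [he] at h3
    linarith
  rw [← hcard1, ← hcard2, ← Finset.card_union_of_disjoint hdisj]
  refine Finset.card_le_card (Finset.union_subset ?_ ?_)
  · exact Finset.image_subset_iff.2 hmY
  · exact Finset.image_subset_iff.2 hqY

lemma exists_isIndepSet_card_eq_maxIndepSigned (s : Sgn) (X : Finset Pt) :
    ∃ I, IsIndepSet X I ∧ (∀ r ∈ I, Oriented s r.1 r.2) ∧ I.card = maxIndepSigned s X := by
  classical
  obtain ⟨I, hI, h⟩ := Finset.exists_mem_eq_sup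
    ((X ×ˢ X).powerset.filter fun I => IsIndepSet X I ∧ ∀ r ∈ I, Oriented s r.1 r.2)
    ⟨∅, by simp [IsIndepSet]⟩ Finset.card
  rw [Finset.mem_filter] at hI
  exact ⟨I, hI.2.1, hI.2.2, h.symm.trans (by unfold maxIndepSigned; congr!)⟩

lemma card_add_maxIndepSigned_le_of_mem {n : ℕ} {σ : Equiv.Perm (Fin n)} {s : Sgn} {k : ℕ}
    (hk : k ∈ signedManhattanCosts s σ) :
    (pointSet σ).card + maxIndepSigned s (pointSet σ) ≤ k := by
  obtain ⟨I, hI, hs, hc⟩ := exists_isIndepSet_card_eq_maxIndepSigned s (pointSet σ)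
  obtain ⟨Y, hXY, hY, rfl⟩ := hk
  rw [← hc]
  exact card_add_card_le_of_isIndepSet hI hs hXY hY

lemma card_le_maxIndepSigned {s : Sgn} {X : Finset Pt} {I : Finset (Pt × Pt)}
    (hI : IsIndepSet X I) (hs : ∀ r ∈ I, Oriented s r.1 r.2) : I.card ≤ maxIndepSigned s X := by
  classical
  unfold maxIndepSigned
  refine Finset.le_sup (f := Finset.card) (Finset.mem_filter.2 ⟨Finset.mem_powerset.2 ?_, hI, hs⟩)
  exact fun r hr => Finset.mem_product.2 ⟨(hI.1 r hr).1, (hI.1 r hr).2.1⟩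

lemma card_le_maxIndep {X : Finset Pt} {I : Finset (Pt × Pt)} (hI : IsIndepSet X I) :
    I.card ≤ maxIndep X := by
  classical
  unfold maxIndep
  refine Finset.le_sup (f := Finset.card) (Finset.mem_filter.2 ⟨Finset.mem_powerset.2 ?_, hI⟩)
  exact fun r hr => Finset.mem_product.2 ⟨(hI.1 r hr).1, (hI.1 r hr).2.1⟩

lemma maxIndepSigned_le_maxIndep (s : Sgn) (X : Finset Pt) : maxIndepSigned s X ≤ maxIndep X := by
  obtain ⟨I, hI, -, hc⟩ := exists_isIndepSet_card_eq_maxIndepSigned s X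
  exact hc ▸ card_le_maxIndep hI

/-- Split a largest independent set by the signs of its rectangles. -/
lemma maxIndep_le_add (X : Finset Pt) :
    maxIndep X ≤ maxIndepSigned .plus X + maxIndepSigned .minus X := by
  classical
  refine Finset.sup_le fun I hI => ?_
  have hI := (Finset.mem_filter.1 hI).2
  have hsub : ∀ s : Sgn, (I.filter fun r => Oriented s r.1 r.2).card ≤ maxIndepSigned s X :=
    fun s => card_le_maxIndepSigned ⟨fun r hr => hI.1 r (Finset.mem_filter.1 hr).1,
      hI.2.mono fun r hr => (Finset.mem_filter.1 hr).1⟩ fun r hr => (Finset.mem_filter.1 hr).2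
  refine le_trans ?_ (add_le_add (hsub .plus) (hsub .minus))
  refine le_trans (Finset.card_le_card fun r hr => ?_) (Finset.card_union_le _ _)
  have := hI.1 r hr
  rw [Finset.mem_union, Finset.mem_filter, Finset.mem_filter]
  rcases lt_or_gt_of_ne this.2.2.2.1 with h | h
  · exact .inl ⟨hr, this.2.2.1, h⟩
  · exact .inr ⟨hr, this.2.2.1, h⟩

/-! ### The greedy sweep -/

section Greedy

variable {n : ℕ} {σ : Equiv.Perm (Fin n)} {s : Sgn}

/-- `q` is visible from `p` in `Y`: no other point of `Y` below the row of `p` lies in the rectangle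
spanned by `q` and `p`. -/
def Visible (s : Sgn) (Y : Finset Pt) (q p : Pt) : Prop :=
  q ∈ Y ∧ Below s q p ∧ ∀ c ∈ Y, c.2 < p.2 → c ≠ q → q.2 ≤ c.2 →
    s.coord q.1 ≤ s.coord c.1 → s.coord p.1 < s.coord c.1

lemma mem_greedyRows_succ {X : Finset Pt} {i : ℕ} {z : Pt} :
    z ∈ greedyRows s X (i + 1) ↔ z ∈ greedyRows s X i ∨ (z ∈ X ∧ z.2 = i + 1) ∨
      ∃ p ∈ X, p.2 = i + 1 ∧ ∃ q ∈ greedyRows s X i, (Oriented s p q ∨ Oriented s q p) ∧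
        (∀ c ∈ greedyRows s X i, c ≠ q → ¬ InRect p q c) ∧ (q.1, p.2) = z := by
  simp only [greedyRows, Finset.mem_union, Finset.mem_filter, Finset.mem_biUnion,
    Finset.mem_image, or_assoc]
  refine or_congr_right (or_congr_right ?_)
  constructor
  · rintro ⟨p, ⟨h1, h2⟩, q, ⟨h3, h4, h5⟩, h6⟩
    exact ⟨p, h1, h2, q, h3, h4, h5, h6⟩
  · rintro ⟨p, h1, h2, q, h3, h4, h5, h6⟩
    exact ⟨p, ⟨h1, h2⟩, q, ⟨h3, h4, h5⟩, h6⟩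

lemma greedyRows_snd {X : Finset Pt} {i : ℕ} {z : Pt} (hz : z ∈ greedyRows s X i) :
    1 ≤ z.2 ∧ z.2 ≤ i := by
  induction i with
  | zero => simp [greedyRows] at hz
  | succ i ih =>
    rcases mem_greedyRows_succ.1 hz with h | ⟨-, h⟩ | ⟨p, -, h, q, -, -, -, rfl⟩
    · have := ih h
      omega
    · omega
    · simp only; omega

lemma mem_greedyRows_iff_of_le {X : Finset Pt} {i j : ℕ} (hij : i ≤ j) {z : Pt} :
    z ∈ greedyRows s X i ↔ z ∈ greedyRows s X j ∧ z.2 ≤ i := by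
  induction j, hij using Nat.le_induction with
  | base => exact ⟨fun h => ⟨h, (greedyRows_snd h).2⟩, fun h => h.1⟩
  | succ j hj ih =>
    rw [ih, mem_greedyRows_succ]
    constructor
    · rintro ⟨h1, h2⟩
      exact ⟨.inl h1, h2⟩
    · rintro ⟨h | ⟨-, h⟩ | ⟨p, -, h, q, -, -, -, rfl⟩, h'⟩
      · exact ⟨h, h'⟩
      · omega
      · simp only at h'; omega

lemma mem_greedyRows_iff {i : ℕ} (hi : i ≤ n) {z : Pt} :
    z ∈ greedyRows s (pointSet σ) i ↔ z ∈ greedy s σ ∧ z.2 ≤ i :=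
  mem_greedyRows_iff_of_le hi

/-- The sweep rule in terms of the final output: below the row of `p` the final output and the
output of the earlier rows agree. -/
lemma mem_greedy {z : Pt} :
    z ∈ greedy s σ ↔ z ∈ pointSet σ ∨
      ∃ p ∈ pointSet σ, ∃ q, Visible s (greedy s σ) q p ∧ (q.1, p.2) = z := by
  have key : ∀ i < n, ∀ p : Pt, p.2 = i + 1 → ∀ q,
      (q ∈ greedyRows s (pointSet σ) i ∧ (Oriented s p q ∨ Oriented s q p) ∧
        (∀ c ∈ greedyRows s (pointSet σ) i, c ≠ q → ¬ InRect p q c)) ↔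
      Visible s (greedy s σ) q p := by
    intro i hi p hp q
    simp only [mem_greedyRows_iff hi.le, oriented_or_iff]
    constructor
    · rintro ⟨⟨h1, h2⟩, h3, h4⟩
      have hqp : Below s q p := h3.resolve_left fun h => by have := h.2; omega
      refine ⟨h1, hqp, fun c hc e1 e2 e3 e4 => ?_⟩
      have := h4 c ⟨hc, by omega⟩ e2
      rw [inRect_comm, inRect_iff hqp.1.le hqp.2.le] at this
      omega
    · rintro ⟨h1, h2, h3⟩
      refine ⟨⟨h1, by have := h2.2; omega⟩, .inr h2, fun c hc e1 e2 => ?_⟩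
      rw [inRect_comm, inRect_iff h2.1.le h2.2.le] at e2
      have := h3 c hc.1 (by omega) e1 (by omega) (by omega)
      omega
  constructor
  · intro hz
    have hz2 : 1 ≤ z.2 ∧ z.2 ≤ n := greedyRows_snd hz
    obtain ⟨i, hi⟩ : ∃ i, z.2 = i + 1 := ⟨z.2 - 1, by omega⟩
    have : z ∈ greedyRows s (pointSet σ) (i + 1) := (mem_greedyRows_iff (by omega)).2 ⟨hz, by omega⟩
    rcases mem_greedyRows_succ.1 this with h | h | ⟨p, h1, h2, q, h3, h4, h5, h6⟩
    · have := (greedyRows_snd h).2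
      omega
    · exact .inl h.1
    · exact .inr ⟨p, h1, q, (key i (by omega) p h2 q).1 ⟨h3, h4, h5⟩, h6⟩
  · have row : ∀ p ∈ pointSet σ, ∃ i < n, p.2 = i + 1 := by
      intro p hp
      have := mem_grid.1 (pointSet_subset_grid hp)
      exact ⟨p.2 - 1, by omega, by omega⟩
    rintro (h | ⟨p, h1, q, h2, rfl⟩)
    · obtain ⟨i, hi, e⟩ := row z h
      exact ((mem_greedyRows_iff (i := i + 1) hi).1 (mem_greedyRows_succ.2 (.inr (.inl ⟨h, e⟩)))).1
    · obtain ⟨i, hi, e⟩ := row p h1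
      obtain ⟨h3, h4, h5⟩ := (key i hi p e q).2 h2
      exact ((mem_greedyRows_iff (i := i + 1) hi).1
        (mem_greedyRows_succ.2 (.inr (.inr ⟨p, h1, e, q, h3, h4, h5, rfl⟩)))).1

lemma pointSet_subset_greedy : pointSet σ ⊆ greedy s σ := fun _ h => mem_greedy.2 (.inl h)

/-- Every output point has an input point at or below it in its column. -/
lemma exists_mem_pointSet_of_mem_greedy {z : Pt} (hz : z ∈ greedy s σ) :
    ∃ a ∈ pointSet σ, a.1 = z.1 ∧ a.2 ≤ z.2 := by
  obtain ⟨m, hm⟩ : ∃ m, z.2 = m := ⟨_, rfl⟩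
  induction m using Nat.strong_induction_on generalizing z with
  | _ m ih =>
    rcases mem_greedy.1 hz with h | ⟨p, -, q, h, rfl⟩
    · exact ⟨z, h, rfl, le_rfl⟩
    · have hqp := h.2.1.2
      obtain ⟨a, ha, h1, h2⟩ := ih q.2 (by simp only at hm; omega) h.1 rfl
      exact ⟨a, ha, h1, by simp only; omega⟩

lemma greedy_subset_grid : greedy s σ ⊆ grid n := by
  intro z hz
  obtain ⟨a, ha, h1, -⟩ := exists_mem_pointSet_of_mem_greedy hz
  have h2 := mem_grid.1 (pointSet_subset_grid ha)
  have h3 : 1 ≤ z.2 ∧ z.2 ≤ n := greedyRows_snd hz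
  rw [mem_grid]
  omega

/-- A point of a rectangle with upper corner `p` that is closest to `p` is visible from `p`. -/
lemma exists_visible {p b : Pt} (hp : p ∈ pointSet σ) (hb : b ∈ greedy s σ) (hbp : Below s b p) :
    ∃ q, Visible s (greedy s σ) q p ∧ s.coord b.1 ≤ s.coord q.1 ∧ b.2 ≤ q.2 := by
  classical
  obtain ⟨q, hq, hmin⟩ := ((greedy s σ).filter fun c => c.2 < p.2 ∧ b.2 ≤ c.2 ∧
    s.coord b.1 ≤ s.coord c.1 ∧ s.coord c.1 ≤ s.coord p.1).exists_min_image
    (fun c => - s.coord c.1 - c.2) ⟨b, Finset.mem_filter.2 ⟨hb, hbp.2, le_rfl, le_rfl, hbp.1.le⟩⟩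
  obtain ⟨hqG, h1, h2, h3, h4⟩ := Finset.mem_filter.1 hq
  have hne : s.coord q.1 ≠ s.coord p.1 := by
    intro h
    obtain ⟨a, ha, e1, e2⟩ := exists_mem_pointSet_of_mem_greedy hqG
    obtain rfl := pointSet_ext_fst ha hp (e1.trans (Sgn.coord_inj.1 h))
    omega
  refine ⟨q, ⟨hqG, ⟨by omega, h1⟩, fun c hc e1 e2 e3 e4 => ?_⟩, h3, h2⟩
  by_contra h5
  have := hmin c (Finset.mem_filter.2 ⟨hc, e1, by omega, by omega, by omega⟩)
  exact e2 (Prod.ext (Sgn.coord_inj.1 (by omega : s.coord c.1 = s.coord q.1)) (by omega))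

lemma signedSatisfied_greedy : SignedSatisfied s (greedy s σ) := by
  rw [signedSatisfied_iff]
  intro a ha b hb hab
  rcases mem_greedy.1 hb with hbX | ⟨p, hp, q, hq, rfl⟩
  · obtain ⟨q, hq, h1, h2⟩ := exists_visible hbX ha hab
    have hqb := hq.2.1
    have hqb' := hqb.1
    have hqb'' := hqb.2
    by_cases hqa : q = a
    · subst hqa
      refine ⟨(q.1, b.2), mem_greedy.2 (.inr ⟨b, hbX, q, hq, rfl⟩), fun h => ?_, fun h => ?_,
        le_rfl, hqb'.le, hqb''.le, le_rfl⟩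
      · have := congrArg Prod.snd h
        simp only at this
        omega
      · rw [← h] at hqb'
        exact hqb'.ne rfl
    · exact ⟨q, hq.1, hqa, fun h => by rw [h] at hqb''; omega, h1, hqb'.le, h2, hqb''.le⟩
  · have k1 := hab.1
    have k2 := hab.2
    have q1 := hq.2.1.1
    have q2 := hq.2.1.2
    simp only at k1 k2
    by_cases h : a.2 ≤ q.2
    · exact ⟨q, hq.1, fun h => by rw [h] at k1; omega,
        fun h => by rw [h] at q2; simp at q2, k1.le, le_rfl, h, q2.le⟩
    · obtain ⟨t, ht, h1, h2⟩ := exists_visible hp ha ⟨k1.trans q1, k2⟩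
      have t1 := ht.2.1.1
      have t2 := ht.2.1.2
      have hlt : s.coord t.1 < s.coord q.1 := by
        by_contra hle
        have := hq.2.2 t ht.1 t2 (fun h => by rw [h] at h2; omega) (by omega) (by omega)
        omega
      refine ⟨(t.1, p.2), mem_greedy.2 (.inr ⟨p, hp, t, ht, rfl⟩), fun h => ?_, fun h => ?_,
        h1, hlt.le, k2.le, le_rfl⟩
      · have := congrArg Prod.snd h
        simp only at this
        omega
      · have := congrArg Prod.fst h
        simp only at this
        rw [this] at hlt
        omega

/-- Let the greedy sweep add `z` in the row of the input point `p`, and let `a` be the input point in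
the column of `z`. Then the rectangle of `a` and `p` contains no output point, except in the column
of `a` and in the row of `p`. For, the points of the column of `z` between `a` and `z` were added
for input points further and further away as one goes down, and each of them was visible when the
next one was added. -/
lemma no_greedy_point {z p : Pt} (hz : z ∈ greedy s σ) (hzX : z ∉ pointSet σ)
    (hp : p ∈ pointSet σ) (hzp : p.2 = z.2) :
    s.coord z.1 < s.coord p.1 ∧ ∀ a ∈ pointSet σ, a.1 = z.1 → ∀ c ∈ greedy s σ,
      s.coord z.1 < s.coord c.1 → s.coord c.1 ≤ s.coord p.1 → a.2 ≤ c.2 → p.2 ≤ c.2 := by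
  obtain ⟨m, hm⟩ : ∃ m, z.2 = m := ⟨_, rfl⟩
  induction m using Nat.strong_induction_on generalizing z p with
  | _ m ih =>
    rcases mem_greedy.1 hz with h | ⟨p', hp', q, hq, rfl⟩
    · exact absurd h hzX
    obtain rfl := pointSet_ext_snd hp hp' hzp
    refine ⟨hq.2.1.1, fun a ha haz c hc h1 h2 h3 => ?_⟩
    by_contra h4
    simp only at h1 haz hm
    have hq2 := hq.2.1.2
    have hcq : c.2 < q.2 := by
      by_contra h5
      have := hq.2.2 c hc (by omega) (fun h => by rw [h] at h1; omega) (by omega) h1.le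
      omega
    have hqX : q ∉ pointSet σ := fun h => by
      obtain rfl := pointSet_ext_fst ha h haz
      omega
    have hqg := mem_grid.1 (greedy_subset_grid hq.1)
    obtain ⟨p', hp', e⟩ := exists_mem_pointSet_snd σ hqg.2.1 hqg.2.2
    obtain ⟨i1, i2⟩ := ih q.2 (by omega) hq.1 hqX hp' e rfl
    have := hq.2.2 p' (pointSet_subset_greedy hp') (by omega) (fun h => hqX (h ▸ hp')) e.ge i1.le
    have := i2 a ha haz c hc h1 (by omega) h3
    omega

/-- The rectangle with the lower-left corner `a` and the upper-right corner `p` in the signed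
coordinates, with the left corner first. -/
def signedRect (s : Sgn) (a p : Pt) : Pt × Pt :=
  match s with
  | .plus => (a, p)
  | .minus => (p, a)

lemma oriented_signedRect {a p : Pt} (h : Below s a p) :
    Oriented s (signedRect s a p).1 (signedRect s a p).2 := by
  cases s <;> simp only [Oriented, signedRect, Below, Sgn.coord] at * <;> omega

lemma inRect_signedRect {a p c : Pt} :
    InRect (signedRect s a p).1 (signedRect s a p).2 c ↔ InRect a p c := by
  cases s
  · rfl
  · exact inRect_comm

lemma inRectInterior_signedRect {a p c : Pt} (h : Below s a p) :
    InRectInterior (signedRect s a p) c ↔ s.coord a.1 < s.coord c.1 ∧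
      s.coord c.1 < s.coord p.1 ∧ a.2 < c.2 ∧ c.2 < p.2 := by
  cases s <;> simp only [InRectInterior, signedRect, Below, Sgn.coord] at * <;> omega

lemma mem_rectCorners_signedRect {a p c : Pt} :
    c ∈ rectCorners (signedRect s a p) ↔ c = a ∨ c = p ∨ c = (a.1, p.2) ∨ c = (p.1, a.2) := by
  cases s
  · simp [rectCorners, signedRect]
  · simp only [rectCorners, signedRect, Finset.mem_insert, Finset.mem_singleton]
    tauto

lemma signedRect_injective {a p a' p' : Pt} (h : signedRect s a p = signedRect s a' p') :
    a = a' ∧ p = p' := by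
  cases s <;> simp only [signedRect, Prod.mk.injEq] at h <;> tauto

/-- Every point that the greedy sweep adds belongs to the rectangle of the input points in its column
and its row, and these rectangles are independent. -/
lemma card_greedy_le : (greedy s σ).card ≤ (pointSet σ).card + maxIndepSigned s (pointSet σ) := by
  classical
  have hex : ∀ z ∈ greedy s σ \ pointSet σ, ∃ a ∈ pointSet σ, ∃ p ∈ pointSet σ,
      z = (a.1, p.2) ∧ Below s a p ∧ ∀ c ∈ greedy s σ, s.coord a.1 < s.coord c.1 →
        s.coord c.1 ≤ s.coord p.1 → a.2 ≤ c.2 → p.2 ≤ c.2 := by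
    intro z hz
    obtain ⟨hz, hzX⟩ := Finset.mem_sdiff.1 hz
    obtain ⟨a, ha, e1, e2⟩ := exists_mem_pointSet_of_mem_greedy hz
    have hzg := mem_grid.1 (greedy_subset_grid hz)
    obtain ⟨p, hp, e3⟩ := exists_mem_pointSet_snd σ hzg.2.1 hzg.2.2
    obtain ⟨h1, h2⟩ := no_greedy_point hz hzX hp e3
    refine ⟨a, ha, p, hp, Prod.ext e1.symm e3.symm, ⟨by rwa [e1], ?_⟩, fun c hc h => ?_⟩
    · have : a.2 ≠ z.2 := fun h => hzX (Prod.ext e1 h ▸ ha)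
      omega
    · rw [e1] at h
      exact h2 a ha e1 c hc h
  choose! a ha p hp hz hap hno using hex
  have hnoX : ∀ z ∈ greedy s σ \ pointSet σ, ∀ c ∈ pointSet σ, c ≠ a z → c ≠ p z →
      s.coord (a z).1 ≤ s.coord c.1 → s.coord c.1 ≤ s.coord (p z).1 → (a z).2 ≤ c.2 →
      (p z).2 < c.2 := by
    intro z hzG c hc h1 h2 h3 h4 h5
    have := hno z hzG c (pointSet_subset_greedy hc)
      (lt_of_le_of_ne h3 fun h => h1 (pointSet_ext_fst hc (ha z hzG) (Sgn.coord_inj.1 h.symm))) h4 h5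
    exact lt_of_le_of_ne this fun h => h2 (pointSet_ext_snd hc (hp z hzG) h.symm)
  have hcard : ((greedy s σ \ pointSet σ).image fun z => signedRect s (a z) (p z)).card =
      (greedy s σ \ pointSet σ).card := by
    refine Finset.card_image_of_injOn fun z hzG w hwG h => ?_
    obtain ⟨h1, h2⟩ := signedRect_injective h
    rw [hz z hzG, hz w hwG, h1, h2]
  have hle : ((greedy s σ \ pointSet σ).image fun z => signedRect s (a z) (p z)).card ≤
      maxIndepSigned s (pointSet σ) := by
    refine card_le_maxIndepSigned ⟨?_, ?_⟩ ?_
    · intro r hr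
      obtain ⟨z, hzG, rfl⟩ := Finset.mem_image.1 hr
      have h1 := oriented_signedRect (hap z hzG)
      have hb := hap z hzG
      refine ⟨?_, ?_, h1.1, ?_, fun c hc e1 e2 => ?_⟩
      · cases s
        exacts [ha z hzG, hp z hzG]
      · cases s
        exacts [hp z hzG, ha z hzG]
      · cases s
        exacts [h1.2.ne, h1.2.ne']
      · rw [inRect_signedRect, inRect_iff hb.1.le hb.2.le]
        rintro ⟨e3, e4, e5, e6⟩
        have hne : c ≠ a z ∧ c ≠ p z := by
          cases s
          exacts [⟨e1, e2⟩, ⟨e2, e1⟩]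
        have := hnoX z hzG c hc hne.1 hne.2 e3 e4 e5
        omega
    · have key : ∀ z ∈ greedy s σ \ pointSet σ, ∀ w ∈ greedy s σ \ pointSet σ,
          ∀ c ∈ rectCorners (signedRect s (a z) (p z)),
            ¬ InRectInterior (signedRect s (a w) (p w)) c := by
        intro z hzG w hwG c hc
        rw [inRectInterior_signedRect (hap w hwG)]
        rintro ⟨h1, h2, h3, h4⟩
        have bz := hap z hzG
        have bz1 := bz.1
        have bz2 := bz.2
        have bw := hap w hwG
        have hX : ∀ c ∈ pointSet σ, s.coord (a w).1 < s.coord c.1 → s.coord c.1 < s.coord (p w).1 →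
            (a w).2 < c.2 → c.2 < (p w).2 → False := by
          intro c hc h1 h2 h3 h4
          have := hnoX w hwG c hc (fun h => by rw [h] at h1; omega)
            (fun h => by rw [h] at h2; omega) h1.le h2.le h3.le
          omega
        rcases mem_rectCorners_signedRect.1 hc with rfl | rfl | rfl | rfl
        · exact hX _ (ha z hzG) h1 h2 h3 h4
        · exact hX _ (hp z hzG) h1 h2 h3 h4
        · rw [← hz z hzG] at h1 h2 h3 h4
          have := hno w hwG z (Finset.mem_sdiff.1 hzG).1 h1 h2.le h3.le
          omega
        · -- here the added point `w` lies inside the rectangle of `z`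
          simp only at h1 h2 h3 h4
          have c1 := hnoX w hwG _ (hp z hzG) (fun h => by rw [h] at h1; omega)
            (fun h => by rw [h] at h2; omega) h1.le h2.le (by omega)
          have c2 : s.coord (a z).1 < s.coord (a w).1 := by
            by_contra h
            have := hnoX w hwG _ (ha z hzG) (fun h => by rw [h] at h3; omega)
              (fun h => by rw [h] at h4; omega) (by omega) (by omega) h3.le
            omega
          have hwG' := (Finset.mem_sdiff.1 hwG).1
          rw [hz w hwG] at hwG'
          have := hno z hzG _ hwG' c2 h1.le (by simp only; omega)
          simp only at this
          omega
      intro r hr t ht _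
      obtain ⟨z, hzG, rfl⟩ := Finset.mem_image.1 (Finset.mem_coe.1 hr)
      obtain ⟨w, hwG, rfl⟩ := Finset.mem_image.1 (Finset.mem_coe.1 ht)
      exact ⟨key z hzG w hwG, key w hwG z hzG⟩
    · intro r hr
      obtain ⟨z, hzG, rfl⟩ := Finset.mem_image.1 hr
      exact oriented_signedRect (hap z hzG)
  have := Finset.card_sdiff_add_card_eq_card (pointSet_subset_greedy (σ := σ) (s := s))
  omega

end Greedy

/-! ### Flip sequences contain staircase paths -/

/-- The segment with endpoints `u` and `v`, for `v` straight above or horizontally displaced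
from `u`. -/
def segOf (u v : Pt) : Seg :=
  if u.1 ≤ v.1 then (u, v) else (v, u)

lemma Forward.contains_segOf {s : Sgn} {u v z : Pt} (h : Forward s u v) :
    (segOf u v).Contains z ↔ s.coord u.1 ≤ s.coord z.1 ∧ s.coord z.1 ≤ s.coord v.1 ∧
      u.2 ≤ z.2 ∧ z.2 ≤ v.2 := by
  cases s <;> simp only [Forward, Sgn.coord, segOf] at * <;> split_ifs <;>
    simp only [Seg.Contains] <;> omega

lemma isEnd_segOf {u v z : Pt} : (segOf u v).IsEnd z ↔ z = u ∨ z = v := by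
  unfold segOf
  split_ifs
  · rfl
  · exact or_comm

lemma Forward.cut {s : Sgn} {u v c : Pt} (h : Forward s u v) (hc : (segOf u v).InInterior c) :
    Forward s u c ∧ Forward s c v ∧ segOf u c ∈ Seg.cut c (segOf u v) ∧
      segOf c v ∈ Seg.cut c (segOf u v) := by
  have h1 := h.contains_segOf.1 hc.1
  have h2 := hc.2
  rw [isEnd_segOf] at h2
  have h3 : ¬ (c.1 = u.1 ∧ c.2 = u.2) := fun h => h2 (.inl (Prod.ext h.1 h.2))
  have h4 : ¬ (c.1 = v.1 ∧ c.2 = v.2) := fun h => h2 (.inr (Prod.ext h.1 h.2))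
  have k1 : Forward s u c := by
    cases s <;> simp only [Forward, Sgn.coord] at * <;> omega
  have k2 : Forward s c v := by
    cases s <;> simp only [Forward, Sgn.coord] at * <;> omega
  refine ⟨k1, k2, ?_⟩
  have hx : (u.1 ≤ v.1 ∧ u.1 ≤ c.1 ∧ c.1 ≤ v.1) ∨ (¬ u.1 ≤ v.1 ∧
      (¬ u.1 ≤ c.1 ∧ ¬ c.1 ≤ v.1)) := by
    cases s <;> simp only [Forward, Sgn.coord] at * <;> omega
  rw [Seg.cut, if_pos hc]
  rcases hx with ⟨e1, e2, e3⟩ | ⟨e1, e2, e3⟩ <;> simp [segOf, e1, e2, e3]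

/-- The segment set `L` contains a segment that leads from `u` to `v`, upwards or in the horizontal
direction of the sign. -/
def UpEdge (s : Sgn) (L : Finset Seg) (u v : Pt) : Prop :=
  Forward s u v ∧ segOf u v ∈ L

lemma UpEdge.of_isVert {s : Sgn} {L : Finset Seg} {t : Seg} (ht : t ∈ L) (h : t.IsVert) :
    UpEdge s L t.1 t.2 :=
  ⟨.inl h, by rw [segOf, if_pos h.1.le]; exact ht⟩

lemma UpEdge.of_isHor_plus {L : Finset Seg} {t : Seg} (ht : t ∈ L) (h : t.IsHor) :
    UpEdge .plus L t.1 t.2 :=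
  ⟨.inr ⟨by simpa [Sgn.coord] using h.2, h.1⟩, by rw [segOf, if_pos h.2.le]; exact ht⟩

lemma UpEdge.of_isHor_minus {L : Finset Seg} {t : Seg} (ht : t ∈ L) (h : t.IsHor) :
    UpEdge .minus L t.2 t.1 :=
  ⟨.inr ⟨by simpa [Sgn.coord] using h.2, h.1.symm⟩, by rw [segOf, if_neg (not_le.2 h.2)]; exact ht⟩

section Valid

variable {e : Sgn} {n : ℕ} {S : RState}

lemma RState.Valid.mem_of_upEdge {s : Sgn} (hS : S.Valid e n) {u v : Pt} (h : UpEdge s S.L u v) :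
    u ∈ S.P ∧ v ∈ S.P := by
  have := (hS.segments _ h.2).2
  unfold segOf at this
  split_ifs at this
  · exact this
  · exact this.symm

lemma RState.Valid.eq_of_vert_up (hS : S.Valid e n) {t u : Seg} (ht : t ∈ S.L) (hu : u ∈ S.L)
    (ht' : t.IsVert) (hu' : u.IsVert) (h : t.1 = u.1) : t = u := by
  by_contra hne
  obtain ⟨⟨a, b⟩, ⟨c, d⟩⟩ := t
  obtain ⟨⟨a', b'⟩, ⟨c', d'⟩⟩ := u
  simp only [Seg.IsVert, Prod.mk.injEq] at *
  have := hS.no_crossing _ ht _ hu (by simpa using hne) (a, b + 1)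
    ⟨by simp, by simp; omega, by simp, by simp; omega⟩
    ⟨by simp; omega, by simp; omega, by simp; omega, by simp; omega⟩
  simp only [Seg.IsEnd, Prod.mk.injEq] at this
  omega

lemma RState.Valid.eq_of_vert_down (hS : S.Valid e n) {t u : Seg} (ht : t ∈ S.L) (hu : u ∈ S.L)
    (ht' : t.IsVert) (hu' : u.IsVert) (h : t.2 = u.2) : t = u := by
  by_contra hne
  obtain ⟨⟨a, b⟩, ⟨c, d⟩⟩ := t
  obtain ⟨⟨a', b'⟩, ⟨c', d'⟩⟩ := u
  simp only [Seg.IsVert, Prod.mk.injEq] at *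
  have := hS.no_crossing _ ht _ hu (by simpa using hne) (a, d - 1)
    ⟨by simp, by simp; omega, by simp; omega, by simp⟩
    ⟨by simp; omega, by simp; omega, by simp; omega, by simp; omega⟩
  simp only [Seg.IsEnd, Prod.mk.injEq] at this
  omega

lemma RState.Valid.eq_of_hor_right (hS : S.Valid e n) {t u : Seg} (ht : t ∈ S.L) (hu : u ∈ S.L)
    (ht' : t.IsHor) (hu' : u.IsHor) (h : t.1 = u.1) : t = u := by
  by_contra hne
  obtain ⟨⟨a, b⟩, ⟨c, d⟩⟩ := t
  obtain ⟨⟨a', b'⟩, ⟨c', d'⟩⟩ := u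
  simp only [Seg.IsHor, Prod.mk.injEq] at *
  have := hS.no_crossing _ ht _ hu (by simpa using hne) (a + 1, b)
    ⟨by simp, by simp; omega, by simp, by simp; omega⟩
    ⟨by simp; omega, by simp; omega, by simp; omega, by simp; omega⟩
  simp only [Seg.IsEnd, Prod.mk.injEq] at this
  omega

lemma RState.Valid.eq_of_hor_left (hS : S.Valid e n) {t u : Seg} (ht : t ∈ S.L) (hu : u ∈ S.L)
    (ht' : t.IsHor) (hu' : u.IsHor) (h : t.2 = u.2) : t = u := by
  by_contra hne
  obtain ⟨⟨a, b⟩, ⟨c, d⟩⟩ := t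
  obtain ⟨⟨a', b'⟩, ⟨c', d'⟩⟩ := u
  simp only [Seg.IsHor, Prod.mk.injEq] at *
  have := hS.no_crossing _ ht _ hu (by simpa using hne) (c - 1, d)
    ⟨by simp; omega, by simp, by simp; omega, by simp⟩
    ⟨by simp; omega, by simp; omega, by simp; omega, by simp; omega⟩
  simp only [Seg.IsEnd, Prod.mk.injEq] at this
  omega

lemma Finset.card_eq_two_of_unique {α : Type*} {A : Finset α} {D E : α → Prop}
    (h : ∀ t ∈ A, D t ∨ E t) (hD : ∀ t ∈ A, ∀ u ∈ A, D t → D u → t = u)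
    (hE : ∀ t ∈ A, ∀ u ∈ A, E t → E u → t = u) (hA : 2 ≤ A.card) :
    A.card = 2 ∧ (∃ t ∈ A, D t) ∧ ∃ u ∈ A, E u := by
  classical
  have hcover : A ⊆ A.filter D ∪ A.filter E := by
    intro t ht
    rw [Finset.mem_union, Finset.mem_filter, Finset.mem_filter]
    exact (h t ht).imp (⟨ht, ·⟩) (⟨ht, ·⟩)
  have h1 : (A.filter D).card ≤ 1 := Finset.card_le_one.2 fun t ht u hu =>
    hD t (Finset.mem_filter.1 ht).1 u (Finset.mem_filter.1 hu).1 (Finset.mem_filter.1 ht).2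
      (Finset.mem_filter.1 hu).2
  have h2 : (A.filter E).card ≤ 1 := Finset.card_le_one.2 fun t ht u hu =>
    hE t (Finset.mem_filter.1 ht).1 u (Finset.mem_filter.1 hu).1 (Finset.mem_filter.1 ht).2
      (Finset.mem_filter.1 hu).2
  have h3 := (Finset.card_le_card hcover).trans (Finset.card_union_le _ _)
  obtain ⟨t, ht⟩ : (A.filter D).Nonempty := Finset.card_pos.1 (by omega)
  obtain ⟨u, hu⟩ : (A.filter E).Nonempty := Finset.card_pos.1 (by omega)
  rw [Finset.mem_filter] at ht hu
  exact ⟨by omega, ⟨t, ht⟩, ⟨u, hu⟩⟩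

/-- Since elbows of sign `e.opp` are forbidden, staircase paths of this sign can be continued in both
directions at every grid point of a valid state. -/
lemma RState.Valid.exists_upEdge (hS : S.Valid e n) {q : Pt} (hq : q ∈ S.P) (hqn : q ∈ grid n) :
    (∃ v, UpEdge e.opp S.L q v) ∧ ∃ u, UpEdge e.opp S.L u q := by
  obtain ⟨hcard, helbow⟩ := hS.elbow_free q hq hqn
  have hat : ∀ t, t ∈ S.at q ↔ t ∈ S.L ∧ t.Contains q := fun t => by
    simp [RState.at]
  have hend : ∀ t ∈ S.at q, t ∈ S.L ∧
      ((t.IsVert ∧ q = t.1) ∨ (t.IsVert ∧ q = t.2) ∨ (t.IsHor ∧ q = t.1) ∨ (t.IsHor ∧ q = t.2)) := by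
    intro t ht
    obtain ⟨h1, h2⟩ := (hat t).1 ht
    have h3 := hS.only_ends t h1 q hq h2
    have h4 := (hS.segments t h1).1
    simp only [Seg.IsEnd] at h3
    tauto
  have vu : ∀ t ∈ S.at q, ∀ u ∈ S.at q, (t.IsVert ∧ q = t.1) → (u.IsVert ∧ q = u.1) → t = u :=
    fun t ht u hu h h' => hS.eq_of_vert_up (hend t ht).1 (hend u hu).1 h.1 h'.1 (h.2.symm.trans h'.2)
  have vd : ∀ t ∈ S.at q, ∀ u ∈ S.at q, (t.IsVert ∧ q = t.2) → (u.IsVert ∧ q = u.2) → t = u :=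
    fun t ht u hu h h' =>
      hS.eq_of_vert_down (hend t ht).1 (hend u hu).1 h.1 h'.1 (h.2.symm.trans h'.2)
  have hr : ∀ t ∈ S.at q, ∀ u ∈ S.at q, (t.IsHor ∧ q = t.1) → (u.IsHor ∧ q = u.1) → t = u :=
    fun t ht u hu h h' =>
      hS.eq_of_hor_right (hend t ht).1 (hend u hu).1 h.1 h'.1 (h.2.symm.trans h'.2)
  have hl : ∀ t ∈ S.at q, ∀ u ∈ S.at q, (t.IsHor ∧ q = t.2) → (u.IsHor ∧ q = u.2) → t = u :=
    fun t ht u hu h h' =>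
      hS.eq_of_hor_left (hend t ht).1 (hend u hu).1 h.1 h'.1 (h.2.symm.trans h'.2)
  cases e
  · -- forbidden: up and left, down and right
    constructor
    · by_contra hno
      obtain ⟨h2, ⟨t, ht, ht'⟩, u, hu, hu'⟩ := Finset.card_eq_two_of_unique
        (D := fun t : Seg => t.IsVert ∧ q = t.2) (E := fun t : Seg => t.IsHor ∧ q = t.1)
        (fun t ht => by
          obtain ⟨h, ⟨h1, rfl⟩ | h1 | h1 | ⟨h1, rfl⟩⟩ := hend t ht
          · exact absurd ⟨_, .of_isVert h h1⟩ hno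
          · exact .inl h1
          · exact .inr h1
          · exact absurd ⟨_, .of_isHor_minus h h1⟩ hno) vd hr hcard
      exact helbow h2 t ht u hu ⟨ht'.1, hu'.1, .inr ⟨ht'.2.symm, hu'.2.symm⟩⟩
    · by_contra hno
      obtain ⟨h2, ⟨t, ht, ht'⟩, u, hu, hu'⟩ := Finset.card_eq_two_of_unique
        (D := fun t : Seg => t.IsVert ∧ q = t.1) (E := fun t : Seg => t.IsHor ∧ q = t.2)
        (fun t ht => by
          obtain ⟨h, h1 | ⟨h1, rfl⟩ | ⟨h1, rfl⟩ | h1⟩ := hend t ht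
          · exact .inl h1
          · exact absurd ⟨_, .of_isVert h h1⟩ hno
          · exact absurd ⟨_, .of_isHor_minus h h1⟩ hno
          · exact .inr h1) vu hl hcard
      exact helbow h2 t ht u hu ⟨ht'.1, hu'.1, .inl ⟨ht'.2.symm, hu'.2.symm⟩⟩
  · -- forbidden: up and right, down and left
    constructor
    · by_contra hno
      obtain ⟨h2, ⟨t, ht, ht'⟩, u, hu, hu'⟩ := Finset.card_eq_two_of_unique
        (D := fun t : Seg => t.IsVert ∧ q = t.2) (E := fun t : Seg => t.IsHor ∧ q = t.2)
        (fun t ht => by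
          obtain ⟨h, ⟨h1, rfl⟩ | h1 | ⟨h1, rfl⟩ | h1⟩ := hend t ht
          · exact absurd ⟨_, .of_isVert h h1⟩ hno
          · exact .inl h1
          · exact absurd ⟨_, .of_isHor_plus h h1⟩ hno
          · exact .inr h1) vd hl hcard
      exact helbow h2 t ht u hu ⟨ht'.1, hu'.1, .inr ⟨ht'.2.symm, hu'.2.symm⟩⟩
    · by_contra hno
      obtain ⟨h2, ⟨t, ht, ht'⟩, u, hu, hu'⟩ := Finset.card_eq_two_of_unique
        (D := fun t : Seg => t.IsVert ∧ q = t.1) (E := fun t : Seg => t.IsHor ∧ q = t.1)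
        (fun t ht => by
          obtain ⟨h, h1 | ⟨h1, rfl⟩ | h1 | ⟨h1, rfl⟩⟩ := hend t ht
          · exact .inl h1
          · exact absurd ⟨_, .of_isVert h h1⟩ hno
          · exact .inr h1
          · exact absurd ⟨_, .of_isHor_plus h h1⟩ hno) vu hr hcard
      exact helbow h2 t ht u hu ⟨ht'.1, hu'.1, .inl ⟨ht'.2.symm, hu'.2.symm⟩⟩

end Valid

/-- `z` is in the closed rectangle with the lower-left corner `u` and the upper-right corner `v`, in
the signed coordinates. -/
def Between (s : Sgn) (u v z : Pt) : Prop :=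
  s.coord u.1 ≤ s.coord z.1 ∧ s.coord z.1 ≤ s.coord v.1 ∧ u.2 ≤ z.2 ∧ z.2 ≤ v.2

/-- The union of all staircase paths of sign `s` that start at `b` and follow segments of `L`. -/
def Region (s : Sgn) (L : Finset Seg) (b z : Pt) : Prop :=
  ∃ u v, Relation.ReflTransGen (UpEdge s L) b u ∧ (u = v ∨ UpEdge s L u v) ∧ Between s u v z

section Region

variable {s : Sgn} {L : Finset Seg} {a b : Pt}

lemma le_of_reach {u : Pt} (h : Relation.ReflTransGen (UpEdge s L) b u) :
    s.coord b.1 ≤ s.coord u.1 ∧ b.2 ≤ u.2 := by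
  induction h with
  | refl => exact ⟨le_rfl, le_rfl⟩
  | tail _ h ih => exact ⟨ih.1.trans h.1.bounds.1, ih.2.trans h.1.bounds.2⟩

lemma Region.le {z : Pt} (h : Region s L b z) : s.coord b.1 ≤ s.coord z.1 ∧ b.2 ≤ z.2 := by
  obtain ⟨u, v, h1, -, h2, -, h3, -⟩ := h
  have := le_of_reach h1
  omega

lemma region_of_reach {u : Pt} (h : Relation.ReflTransGen (UpEdge s L) b u) : Region s L b u :=
  ⟨u, u, h, .inl rfl, le_rfl, le_rfl, le_rfl, le_rfl⟩

lemma exists_region_fst_of_reach {u : Pt} (h : Relation.ReflTransGen (UpEdge s L) b u) {x : ℕ}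
    (h₁ : s.coord b.1 ≤ s.coord x) (h₂ : s.coord x ≤ s.coord u.1) :
    ∃ y ≤ u.2, Region s L b (x, y) := by
  induction h with
  | refl =>
    obtain rfl : x = b.1 := Sgn.coord_inj.1 (le_antisymm h₂ h₁)
    exact ⟨b.2, le_rfl, region_of_reach .refl⟩
  | @tail u v hu huv ih =>
    by_cases hx : s.coord x ≤ s.coord u.1
    · obtain ⟨y, hy, h⟩ := ih hx
      exact ⟨y, hy.trans huv.1.bounds.2, h⟩
    · exact ⟨v.2, le_rfl, u, v, hu, .inr huv, by simp only; omega, h₂, huv.1.bounds.2, le_rfl⟩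

lemma exists_region_snd_of_reach {u : Pt} (h : Relation.ReflTransGen (UpEdge s L) b u) {y : ℕ}
    (h₁ : b.2 ≤ y) (h₂ : y ≤ u.2) :
    ∃ x, s.coord x ≤ s.coord u.1 ∧ Region s L b (x, y) := by
  induction h with
  | refl =>
    obtain rfl : y = b.2 := le_antisymm h₂ h₁
    exact ⟨b.1, le_rfl, region_of_reach .refl⟩
  | @tail u v hu huv ih =>
    by_cases hy : y ≤ u.2
    · obtain ⟨x, hx, h⟩ := ih hy
      exact ⟨x, hx.trans huv.1.bounds.1, h⟩
    · exact ⟨v.1, le_rfl, u, v, hu, .inr huv, huv.1.bounds.1, le_rfl, by simp only; omega, h₂⟩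

/-- Following a staircase path backwards from `z`, all columns down to that of `b` are met at or
below the height of `z`. -/
lemma Region.exists_fst {z : Pt} (h : Region s L b z) {x : ℕ}
    (h₁ : s.coord b.1 ≤ s.coord x) (h₂ : s.coord x ≤ s.coord z.1) :
    ∃ y ≤ z.2, Region s L b (x, y) := by
  obtain ⟨u, v, hu, huv, hz⟩ := h
  by_cases hx : s.coord x ≤ s.coord u.1
  · obtain ⟨y, hy, h⟩ := exists_region_fst_of_reach hu h₁ hx
    exact ⟨y, hy.trans hz.2.2.1, h⟩
  · exact ⟨z.2, le_rfl, u, v, hu, huv, by simp only; omega, h₂.trans hz.2.1, hz.2.2⟩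

lemma Region.exists_snd {z : Pt} (h : Region s L b z) {y : ℕ} (h₁ : b.2 ≤ y) (h₂ : y ≤ z.2) :
    ∃ x, s.coord x ≤ s.coord z.1 ∧ Region s L b (x, y) := by
  obtain ⟨u, v, hu, huv, hz⟩ := h
  by_cases hy : y ≤ u.2
  · obtain ⟨x, hx, h⟩ := exists_region_snd_of_reach hu h₁ hy
    exact ⟨x, hx.trans hz.1, h⟩
  · exact ⟨z.1, le_rfl, u, v, hu, huv, hz.1, hz.2.1, by simp only; omega, h₂.trans hz.2.2.2⟩

/-- Some staircase path from `b` meets the row of `a` at `a` or before it reaches the column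
of `a`. -/
def PassesBefore (s : Sgn) (L : Finset Seg) (b a : Pt) : Prop :=
  ∃ z, Region s L b z ∧ z.2 = a.2 ∧ s.coord z.1 ≤ s.coord a.1

/-- Some staircase path from `b` meets the column of `a` at `a` or below. -/
def PassesBelow (s : Sgn) (L : Finset Seg) (b a : Pt) : Prop :=
  ∃ z, Region s L b z ∧ z.1 = a.1 ∧ z.2 ≤ a.2

lemma mem_grid_of_between {n : ℕ} {z : Pt} (ha : a ∈ grid n) (hb : b ∈ grid n)
    (h : Between s b a z) : z ∈ grid n := by
  rw [mem_grid] at *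
  cases s <;> simp only [Between, Sgn.coord] at h <;> omega

variable {e : Sgn} {n : ℕ} {S : RState}

lemma RState.Valid.mem_of_reach (hS : S.Valid e n) (hb : b ∈ S.P) {u : Pt}
    (h : Relation.ReflTransGen (UpEdge s S.L) b u) : u ∈ S.P := by
  cases h with
  | refl => exact hb
  | tail _ h => exact (hS.mem_of_upEdge h).2

/-- A staircase path from `b` can be continued until it leaves the rectangle of `b` and `a`, through
the side opposite to `b` in one of the two directions. -/
lemma RState.Valid.passesBefore_or_passesBelow (hS : S.Valid e n) (hb : b ∈ S.P)
    (hbn : b ∈ grid n) (han : a ∈ grid n) (hba : Below e.opp b a) :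
    PassesBefore e.opp S.L b a ∨ PassesBelow e.opp S.L b a := by
  suffices ∀ (m : ℕ) (u : Pt), Relation.ReflTransGen (UpEdge e.opp S.L) b u →
      e.opp.coord u.1 ≤ e.opp.coord a.1 → u.2 ≤ a.2 →
      (e.opp.coord a.1 - e.opp.coord u.1) + ((a.2 : ℤ) - u.2) = m →
      PassesBefore e.opp S.L b a ∨ PassesBelow e.opp S.L b a from
    this _ b .refl hba.1.le hba.2.le (Int.toNat_of_nonneg (by
      have h1 := hba.1
      have h2 := hba.2
      omega)).symm
  intro m
  induction m using Nat.strong_induction_on with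
  | _ m ih =>
    intro u hu h1 h2 hm
    obtain ⟨h3, h4⟩ := le_of_reach hu
    obtain ⟨v, huv⟩ := (hS.exists_upEdge (hS.mem_of_reach hb hu)
      (mem_grid_of_between han hbn ⟨h3, h1, h4, h2⟩)).1
    rcases huv.1 with ⟨k1, k2⟩ | ⟨k1, k2⟩
    · by_cases hv : v.2 ≤ a.2
      · rw [k1] at h1 hm
        exact ih _ (by omega) v (hu.tail huv) h1 hv (Int.toNat_of_nonneg (by omega)).symm
      · exact .inl ⟨(u.1, a.2), ⟨u, v, hu, .inr huv, le_rfl, by rw [k1], h2, by simp only; omega⟩,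
          rfl, h1⟩
    · by_cases hv : e.opp.coord v.1 ≤ e.opp.coord a.1
      · exact ih _ (by omega) v (hu.tail huv) hv (by omega) (Int.toNat_of_nonneg (by omega)).symm
      · exact .inr ⟨(a.1, u.2), ⟨u, v, hu, .inr huv, h1, by simp only; omega, le_rfl, k2.le⟩,
          rfl, h2⟩

/-- A staircase path from `b` that meets a segment ends up in the upper endpoint of it, since
segments do not cross. -/
lemma RState.Valid.reach_of_region (hS : S.Valid e n) (hb : b ∈ S.P) {p q z : Pt}
    (hpq : UpEdge s S.L p q) (hz : Region s S.L b z) (hz' : Between s p q z) (hzp : z ≠ p) :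
    Relation.ReflTransGen (UpEdge s S.L) b q := by
  obtain ⟨u, v, hu, huv, huz⟩ := hz
  have hc := hpq.1.contains_segOf.2 hz'
  rcases huv with rfl | huv
  · obtain rfl : z = u := Prod.ext (Sgn.coord_inj.1 (le_antisymm huz.2.1 huz.1))
      (le_antisymm huz.2.2.2 huz.2.2.1)
    have := hS.only_ends _ hpq.2 z (hS.mem_of_reach hb hu) hc
    rw [isEnd_segOf] at this
    exact this.resolve_left hzp ▸ hu
  · have hc' := huv.1.contains_segOf.2 huz
    by_cases he : segOf p q = segOf u v
    · have h1 : p = u ∨ p = v := isEnd_segOf.1 (he ▸ isEnd_segOf.2 (.inl rfl))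
      have h2 : q = u ∨ q = v := isEnd_segOf.1 (he ▸ isEnd_segOf.2 (.inr rfl))
      rcases h2 with rfl | rfl
      · exact hu
      · exact hu.tail huv
    · obtain ⟨h1, h2⟩ := hS.no_crossing _ hpq.2 _ huv.2 he z hc hc'
      rw [isEnd_segOf] at h1 h2
      obtain rfl := h1.resolve_left hzp
      rcases h2 with rfl | rfl
      · exact hu
      · exact hu.tail huv

/-- If staircase paths from `b` pass on both sides of `a`, then one of them reaches `a`: a staircase
walk backwards from `a` cannot leave the area between the two paths without meeting one of them. -/
lemma RState.Valid.reach_of_passes (hS : S.Valid e n) (hb : b ∈ S.P) (ha : a ∈ S.P)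
    (hbn : b ∈ grid n) (han : a ∈ grid n) (h₁ : PassesBefore e.opp S.L b a)
    (h₂ : PassesBelow e.opp S.L b a) : Relation.ReflTransGen (UpEdge e.opp S.L) b a := by
  suffices ∀ (m : ℕ) (q : Pt), Relation.ReflTransGen (UpEdge e.opp S.L) q a → q ∈ S.P →
      PassesBefore e.opp S.L b q → PassesBelow e.opp S.L b q →
      (e.opp.coord q.1 - e.opp.coord b.1) + ((q.2 : ℤ) - b.2) = m →
      Relation.ReflTransGen (UpEdge e.opp S.L) b a by
    refine this _ a .refl ha h₁ h₂ (Int.toNat_of_nonneg ?_).symm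
    obtain ⟨z, hz, h3, -⟩ := h₁
    obtain ⟨w, hw, h4, -⟩ := h₂
    have h5 := hz.le.2
    have h6 := hw.le.1
    rw [h4] at h6
    omega
  intro m
  induction m using Nat.strong_induction_on with
  | _ m ih =>
    intro q hq hqP hq1 hq2 hm
    obtain ⟨z, hz, hz1, hz2⟩ := hq1
    obtain ⟨w, hw, hw1, hw2⟩ := hq2
    have hzb := hz.le.2
    have hwb := hw.le.1
    have hqa := le_of_reach hq
    rw [hw1] at hwb
    obtain ⟨p, hpq⟩ := (hS.exists_upEdge hqP (mem_grid_of_between han hbn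
      ⟨hwb, hqa.1, by omega, hqa.2⟩)).2
    have hpP := (hS.mem_of_upEdge hpq).1
    have hpa : Relation.ReflTransGen (UpEdge e.opp S.L) p a := .head hpq hq
    rcases hpq.1 with ⟨k1, k2⟩ | ⟨k1, k2⟩
    · by_cases hwp : w.2 ≤ p.2
      · obtain ⟨x, hx1, hx2⟩ := hz.exists_snd (y := p.2)
          (by have := hw.le.2; omega) (by omega)
        have := hx2.le
        refine ih _ ?_ p hpa hpP ⟨_, hx2, rfl, by simp only; rw [k1]; omega⟩
          ⟨w, hw, by rw [hw1, k1], hwp⟩ (Int.toNat_of_nonneg ?_).symm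
        · rw [k1]; omega
        · rw [k1]; omega
      · exact (hS.reach_of_region hb hpq hw ⟨by rw [hw1, k1], by rw [hw1], by omega, hw2⟩
          (by rintro rfl; omega)).trans hq
    · by_cases hzp : e.opp.coord z.1 ≤ e.opp.coord p.1
      · obtain ⟨y, hy1, hy2⟩ := hw.exists_fst (x := p.1)
          (by have := hz.le.1; omega) (by rw [hw1]; omega)
        have := hy2.le
        simp only at this
        exact ih _ (by omega) p hpa hpP ⟨z, hz, by omega, hzp⟩
          ⟨_, hy2, rfl, by simp only; omega⟩ (Int.toNat_of_nonneg (by omega)).symm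
      · exact (hS.reach_of_region hb hpq hz ⟨by omega, hz2, by omega, by omega⟩
          (by rintro rfl; omega)).trans hq

/-! ### Lower bound for rectangulations -/

lemma mem_flip {t : Seg} {c d : Pt} : t ∈ (S.flip c d).L ↔ t = (c, d) ∨
    (t ∈ S.L ∧ ¬ t.InInterior c ∧ ¬ t.InInterior d) ∨
    (∃ u ∈ S.L, t ∈ Seg.cut c u) ∨ ∃ u ∈ S.L, t ∈ Seg.cut d u := by
  simp [RState.flip]

/-- Flips refine segments, hence they preserve the union of the staircase paths. -/
lemma UpEdge.flip {c d u v : Pt} (h : UpEdge s S.L u v) :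
    UpEdge s (S.flip c d).L u v ∨ ∃ m, UpEdge s (S.flip c d).L u m ∧ UpEdge s (S.flip c d).L m v := by
  by_cases hc : (segOf u v).InInterior c
  · obtain ⟨h1, h2, h3, h4⟩ := h.1.cut hc
    exact .inr ⟨c, ⟨h1, mem_flip.2 (.inr (.inr (.inl ⟨_, h.2, h3⟩)))⟩,
      ⟨h2, mem_flip.2 (.inr (.inr (.inl ⟨_, h.2, h4⟩)))⟩⟩
  by_cases hd : (segOf u v).InInterior d
  · obtain ⟨h1, h2, h3, h4⟩ := h.1.cut hd
    exact .inr ⟨d, ⟨h1, mem_flip.2 (.inr (.inr (.inr ⟨_, h.2, h3⟩)))⟩,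
      ⟨h2, mem_flip.2 (.inr (.inr (.inr ⟨_, h.2, h4⟩)))⟩⟩
  · exact .inl ⟨h.1, mem_flip.2 (.inr (.inl ⟨h.2, hc, hd⟩))⟩

lemma reach_flip {c d u : Pt} (h : Relation.ReflTransGen (UpEdge s S.L) b u) :
    Relation.ReflTransGen (UpEdge s (S.flip c d).L) b u := by
  induction h with
  | refl => exact .refl
  | tail _ h ih =>
    rcases h.flip (c := c) (d := d) with h | ⟨m, h1, h2⟩
    · exact ih.tail h
    · exact (ih.tail h1).tail h2

lemma Region.flip {c d z : Pt} (h : Region s S.L b z) : Region s (S.flip c d).L b z := by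
  obtain ⟨u, v, hu, huv, hz⟩ := h
  have hu' := reach_flip (c := c) (d := d) hu
  rcases huv with rfl | huv
  · exact ⟨u, u, hu', .inl rfl, hz⟩
  rcases huv.flip (c := c) (d := d) with h | ⟨m, h1, h2⟩
  · exact ⟨u, v, hu', .inr h, hz⟩
  · obtain ⟨z1, z2, z3, z4⟩ := hz
    have b1 := h1.1.bounds
    have b2 := h2.1.bounds
    have f1 := huv.1
    by_cases hm : s.coord z.1 ≤ s.coord m.1 ∧ z.2 ≤ m.2
    · exact ⟨u, m, hu', .inr h1, z1, hm.1, z3, hm.2⟩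
    · refine ⟨m, v, hu'.tail h1, .inr h2, ?_, z2, ?_, z4⟩
      · rcases f1 with ⟨k1, k2⟩ | ⟨k1, k2⟩
        · rw [k1] at b1 z1; omega
        · omega
      · rcases f1 with ⟨k1, k2⟩ | ⟨k1, k2⟩
        · rw [k1] at b1 z1; omega
        · omega

lemma Region.mono {L' : Finset Seg} (hL : L ⊆ L') {z : Pt} (h : Region s L b z) :
    Region s L' b z := by
  obtain ⟨u, v, hu, huv, hz⟩ := h
  exact ⟨u, v, Relation.ReflTransGen.mono (fun _ _ h => ⟨h.1, hL h.2⟩) _ _ hu, huv.imp id fun h => ⟨h.1, hL h.2⟩, hz⟩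

end Region

section LowerBound

variable {e : Sgn} {n k : ℕ} {σ : Equiv.Perm (Fin n)} {T : RState}

lemma FlipsTo.points_subset {S : RState} (h : FlipsTo e n S k T) : S.P ⊆ T.P := by
  induction h with
  | refl => exact subset_rfl
  | step _ h ih =>
    obtain ⟨a, -, b, -, -, -, hP, -⟩ := h
    rw [hP]
    exact ih.trans Finset.subset_union_left

lemma FlipsTo.card_points_le {S : RState} (h : FlipsTo e n S k T) :
    T.P.card ≤ S.P.card + 2 * k := by
  classical
  induction h with
  | refl => simp
  | step _ h ih =>
    obtain ⟨a, -, b, -, -, -, hP, -⟩ := h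
    rw [hP]
    have h1 := Finset.card_union_le (α := Pt) ‹RState›.P {a, b}
    have h2 := Finset.card_le_two (a := a) (b := b)
    simp only [RState.flip]
    refine (Finset.card_union_le _ _).trans ?_
    omega

/-- Initially the only staircase path from `b` goes straight up and passes before `a`. As long as the
points of the states do not contain a staircase path from `b` to `a`, this property is preserved: at
the moment of a change, staircase paths on both sides of `a` would be present. -/
lemma FlipsTo.passesBefore_or_mPath (h : FlipsTo e n (initialState σ) k T) {a b : Pt}
    (ha : a ∈ pointSet σ) (hb : b ∈ pointSet σ) (hba : Below e.opp b a) :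
    PassesBefore e.opp T.L b a ∨ MPath e.opp T.P b a := by
  have han := pointSet_subset_grid ha
  have hbn := pointSet_subset_grid hb
  induction h with
  | refl =>
    have h1 := (mem_grid.1 hbn).2
    have h2 := (mem_grid.1 han).2
    have h3 := hba.2
    have hL : (b, (b.1, n + 1)) ∈ (initialState σ).L :=
      Finset.mem_biUnion.2 ⟨b, hb, by simp⟩
    refine .inl ⟨(b.1, a.2), ⟨b, (b.1, n + 1), .refl, .inr ?_, le_rfl, le_rfl, h3.le, ?_⟩,
      rfl, hba.1.le⟩
    · exact UpEdge.of_isVert (t := (b, (b.1, n + 1))) hL ⟨rfl, by simp only; omega⟩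
    · simp only; omega
  | @step k S T hS hST ih =>
    have hsub : pointSet σ ⊆ S.P := Finset.subset_union_left.trans hS.points_subset
    obtain ⟨c, -, d, -, -, hF, hTP, hTL, hT⟩ := hST
    have hPF : S.P ⊆ (S.flip c d).P := Finset.subset_union_left
    rcases ih with ⟨z, hz, hz'⟩ | hp
    · have hW : PassesBefore e.opp (S.flip c d).L b a := ⟨z, hz.flip, hz'⟩
      refine (hT.passesBefore_or_passesBelow (hTP ▸ hPF (hsub hb)) hbn han hba).imp id ?_
      rintro ⟨w, hw, hw'⟩
      have := hF.reach_of_passes (hPF (hsub hb)) (hPF (hsub ha)) hbn han hW ⟨w, hw.mono hTL, hw'⟩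
      refine Relation.ReflTransGen.mono (fun u v huv => ?_) _ _ this
      rw [hTP]
      exact ⟨(hF.mem_of_upEdge huv).1, (hF.mem_of_upEdge huv).2, huv.1⟩
    · refine .inr (Relation.ReflTransGen.mono (fun u v huv => ?_) _ _ hp)
      rw [hTP]
      exact ⟨hPF huv.1, hPF huv.2.1, huv.2.2⟩

lemma Region.snd_eq_of_isHor {s : Sgn} {L : Finset Seg} (hL : ∀ t ∈ L, t.IsHor) {b z : Pt}
    (h : Region s L b z) : z.2 = b.2 := by
  have key : ∀ u v, UpEdge s L u v → v.2 = u.2 := by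
    intro u v h
    have := (hL _ h.2).1
    unfold segOf at this
    split_ifs at this
    · exact this.symm
    · exact this
  obtain ⟨u, v, hu, huv, -, -, h1, h2⟩ := h
  have : u.2 = b.2 := by
    clear h1 h2 huv
    induction hu with
    | refl => rfl
    | tail _ h ih => rw [key _ _ h, ih]
  have hv : v.2 = u.2 := huv.elim (fun h => h ▸ rfl) (key u v)
  omega

lemma mPath_of_isEndState (h : FlipsTo e n (initialState σ) k T) (hT : IsEndState e σ T) {a b : Pt}
    (ha : a ∈ pointSet σ) (hb : b ∈ pointSet σ) (hba : Below e.opp b a) :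
    MPath e.opp T.P b a := by
  refine (h.passesBefore_or_mPath ha hb hba).resolve_left ?_
  rintro ⟨z, hz, h1, -⟩
  have h2 := hz.snd_eq_of_isHor hT.horizontal
  have h3 := hba.2
  omega

/-- Each flip produces horizontal segments in at most one new row. -/
lemma FlipsTo.card_rows_le (h : FlipsTo e n (initialState σ) k T) :
    (∀ t ∈ T.L, t.IsHor ∨ t.IsVert) ∧
      ∃ R : Finset ℕ, R.card ≤ k ∧ ∀ t ∈ T.L, t.IsHor → t.1.2 ∈ R := by
  classical
  induction h with
  | refl =>
    have hv : ∀ t ∈ (initialState σ).L, t.IsVert := by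
      intro t ht
      obtain ⟨p, hp, ht⟩ := Finset.mem_biUnion.1 ht
      have := mem_grid.1 (pointSet_subset_grid hp)
      rw [Finset.mem_insert, Finset.mem_singleton] at ht
      rcases ht with rfl | rfl
      · exact ⟨rfl, by simp only; omega⟩
      · exact ⟨rfl, by simp only; omega⟩
    exact ⟨fun t ht => .inr (hv t ht), ∅, by simp, fun t ht h => absurd (hv t ht).1 h.2.ne⟩
  | @step k S T hS hST ih =>
    obtain ⟨hS', R, hR, hR'⟩ := ih
    obtain ⟨c, -, d, -, -, hF, -, hTL, hT⟩ := hST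
    refine ⟨fun t ht => (hT.segments t ht).1, insert c.2 R,
      (Finset.card_insert_le _ _).trans (by omega), fun t ht hth => ?_⟩
    have hcut : ∀ c, ∀ u ∈ S.L, t ∈ Seg.cut c u → t.1.2 ∈ R := by
      intro c u hu htu
      unfold Seg.cut at htu
      split_ifs at htu with hi
      · have hic := hi.1
        simp only [Seg.Contains] at hic
        simp only [Finset.mem_insert, Finset.mem_singleton] at htu
        rcases hS' u hu with h' | h'
        · have := hR' u hu h'
          have h1 := h'.1
          rcases htu with rfl | rfl
          · exact this
          · simp only
            rwa [show c.2 = u.1.2 by omega]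
        · have h1 := h'.1
          have h2 := hth.2
          rcases htu with rfl | rfl <;> simp only at h2 <;> omega
      · simp at htu
    rcases mem_flip.1 (hTL ht) with rfl | h | ⟨u, hu, h⟩ | ⟨u, hu, h⟩
    · exact Finset.mem_insert_self _ _
    · exact Finset.mem_insert_of_mem (hR' t h.1 hth)
    · exact Finset.mem_insert_of_mem (hcut c u hu h)
    · exact Finset.mem_insert_of_mem (hcut d u hu h)

lemma le_of_isEndState (h : FlipsTo e n (initialState σ) k T) (hT : IsEndState e σ T) : n ≤ k := by
  obtain ⟨-, R, hR, hR'⟩ := h.card_rows_le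
  have : Finset.Icc 1 n ⊆ R := by
    intro y hy
    obtain ⟨t, ht, hc⟩ := hT.cover 0 (by simp) y hy
    have h1 := hT.horizontal t ht
    have h2 := hR' t ht h1
    have h3 := h1.1
    simp only [Seg.Contains] at hc
    rwa [show y = t.1.2 by omega]
  simpa using (Finset.card_le_card this).trans hR

lemma card_margin_le : (margin n).card ≤ 4 * n := by
  refine Finset.card_biUnion_le.trans ?_
  refine (Finset.sum_le_card_nsmul _ _ 4 fun i _ => Finset.card_le_four).trans ?_
  simp [mul_comm]

/-- The points of a solution of the rectangulation problem form a signed manhattan network. -/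
lemma exists_mem_signedManhattanCosts_le (hk : k ∈ rectCosts e σ) :
    ∃ m ∈ signedManhattanCosts e.opp σ, m ≤ 7 * k := by
  obtain ⟨T, h, hT⟩ := hk
  refine ⟨_, card_mem_signedManhattanCosts σ (Finset.subset_union_left.trans hT.points)
    fun b hb a ha hba => mPath_of_isEndState h hT ha hb hba, ?_⟩
  have h1 := h.card_points_le
  have h2 : (initialState σ).P.card ≤ n + 4 * n := by
    refine (Finset.card_union_le _ _).trans (add_le_add ?_ card_margin_le)
    rw [card_pointSet]
  have h3 := le_of_isEndState h hT
  omega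

end LowerBound

/-! ### Flip sequences from satisfied sets -/

section UpperBound

variable {n : ℕ} {e s : Sgn} {Y : Finset Pt}

lemma mem_margin {p : Pt} : p ∈ margin n ↔
    ((1 ≤ p.1 ∧ p.1 ≤ n) ∧ (p.2 = 0 ∨ p.2 = n + 1)) ∨
    ((1 ≤ p.2 ∧ p.2 ≤ n) ∧ (p.1 = 0 ∨ p.1 = n + 1)) := by
  obtain ⟨x, y⟩ := p
  simp only [margin, Finset.mem_biUnion, Finset.mem_Icc, Finset.mem_insert, Finset.mem_singleton,
    Prod.mk.injEq]
  constructor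
  · rintro ⟨i, h, h'⟩
    omega
  · rintro (⟨h, h'⟩ | ⟨h, h'⟩)
    · exact ⟨x, h, by omega⟩
    · exact ⟨y, h, by omega⟩

lemma mem_board {p : Pt} (h : p ∈ grid n ∨ p ∈ margin n) : p ∈ board n := by
  obtain ⟨x, y⟩ := p
  rw [mem_grid, mem_margin] at h
  simp only [board, Finset.mem_sdiff, Finset.mem_product, Finset.mem_range, Finset.mem_insert,
    Finset.mem_singleton, Prod.mk.injEq] at *
  omega

open scoped Classical in
/-- The vertical segments between consecutive points of `Y` and the margin. -/
noncomputable def vertEdges (n : ℕ) (Y : Finset Pt) : Finset Seg :=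
  ((Y ∪ margin n) ×ˢ (Y ∪ margin n)).filter fun t => t.IsVert ∧ (1 ≤ t.1.1 ∧ t.1.1 ≤ n) ∧
    ∀ p ∈ Y ∪ margin n, t.Contains p → t.IsEnd p

open scoped Classical in
/-- The horizontal segments between consecutive points of `Y` and the margin. -/
noncomputable def horEdges (n : ℕ) (Y : Finset Pt) : Finset Seg :=
  ((Y ∪ margin n) ×ˢ (Y ∪ margin n)).filter fun t => t.IsHor ∧ (1 ≤ t.1.2 ∧ t.1.2 ≤ n) ∧
    ∀ p ∈ Y ∪ margin n, t.Contains p → t.IsEnd p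

lemma mem_vertEdges {t : Seg} : t ∈ vertEdges n Y ↔ (t.1 ∈ Y ∪ margin n ∧ t.2 ∈ Y ∪ margin n) ∧
    t.IsVert ∧ (1 ≤ t.1.1 ∧ t.1.1 ≤ n) ∧ ∀ p ∈ Y ∪ margin n, t.Contains p → t.IsEnd p := by
  classical
  rw [vertEdges, Finset.mem_filter, Finset.mem_product]

lemma mem_horEdges {t : Seg} : t ∈ horEdges n Y ↔ (t.1 ∈ Y ∪ margin n ∧ t.2 ∈ Y ∪ margin n) ∧
    t.IsHor ∧ (1 ≤ t.1.2 ∧ t.1.2 ≤ n) ∧ ∀ p ∈ Y ∪ margin n, t.Contains p → t.IsEnd p := by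
  classical
  rw [horEdges, Finset.mem_filter, Finset.mem_product]

lemma snd_le_of_mem {p : Pt} (hY : Y ⊆ grid n) (hp : p ∈ Y ∪ margin n) :
    p.1 ≤ n + 1 ∧ p.2 ≤ n + 1 := by
  rcases Finset.mem_union.1 hp with h | h
  · have := mem_grid.1 (hY h)
    omega
  · rw [mem_margin] at h
    omega

/-- Above every height of a column there is a next point of `Y` or the margin, and one at or
below it. -/
lemma exists_vertEdge {x y : ℕ} (hx : 1 ≤ x ∧ x ≤ n) (hy : y ≤ n) :
    ∃ t ∈ vertEdges n Y, t.1.1 = x ∧ t.1.2 ≤ y ∧ y < t.2.2 := by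
  classical
  obtain ⟨a, ha, hmax⟩ := ((Y ∪ margin n).filter fun p => p.1 = x ∧ p.2 ≤ y).exists_max_image
    Prod.snd ⟨(x, 0), Finset.mem_filter.2 ⟨Finset.mem_union_right _ (mem_margin.2 (by simp; omega)),
      rfl, by simp⟩⟩
  obtain ⟨b, hb, hmin⟩ := ((Y ∪ margin n).filter fun p => p.1 = x ∧ y < p.2).exists_min_image
    Prod.snd ⟨(x, n + 1), Finset.mem_filter.2 ⟨Finset.mem_union_right _
      (mem_margin.2 (by simp; omega)), rfl, by simp; omega⟩⟩
  obtain ⟨ha, a1, a2⟩ := Finset.mem_filter.1 ha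
  obtain ⟨hb, b1, b2⟩ := Finset.mem_filter.1 hb
  refine ⟨(a, b), mem_vertEdges.2 ⟨⟨ha, hb⟩, ⟨by simp only; omega, by simp only; omega⟩,
    by simp only; omega, fun p hp hc => ?_⟩, a1, a2, b2⟩
  simp only [Seg.Contains] at hc
  simp only [Seg.IsEnd, Prod.ext_iff]
  by_cases hpy : p.2 ≤ y
  · have := hmax p (Finset.mem_filter.2 ⟨hp, by omega, hpy⟩)
    omega
  · have := hmin p (Finset.mem_filter.2 ⟨hp, by omega, by omega⟩)
    omega

lemma exists_horEdge {x y : ℕ} (hx : x ≤ n) (hy : 1 ≤ y ∧ y ≤ n) :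
    ∃ t ∈ horEdges n Y, t.1.2 = y ∧ t.1.1 ≤ x ∧ x < t.2.1 := by
  classical
  obtain ⟨a, ha, hmax⟩ := ((Y ∪ margin n).filter fun p => p.2 = y ∧ p.1 ≤ x).exists_max_image
    Prod.fst ⟨(0, y), Finset.mem_filter.2 ⟨Finset.mem_union_right _ (mem_margin.2 (by simp; omega)),
      rfl, by simp⟩⟩
  obtain ⟨b, hb, hmin⟩ := ((Y ∪ margin n).filter fun p => p.2 = y ∧ x < p.1).exists_min_image
    Prod.fst ⟨(n + 1, y), Finset.mem_filter.2 ⟨Finset.mem_union_right _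
      (mem_margin.2 (by simp; omega)), rfl, by simp; omega⟩⟩
  obtain ⟨ha, a1, a2⟩ := Finset.mem_filter.1 ha
  obtain ⟨hb, b1, b2⟩ := Finset.mem_filter.1 hb
  refine ⟨(a, b), mem_horEdges.2 ⟨⟨ha, hb⟩, ⟨by simp only; omega, by simp only; omega⟩,
    by simp only; omega, fun p hp hc => ?_⟩, a1, a2, b2⟩
  simp only [Seg.Contains] at hc
  simp only [Seg.IsEnd, Prod.ext_iff]
  by_cases hpx : p.1 ≤ x
  · have := hmax p (Finset.mem_filter.2 ⟨hp, by omega, hpx⟩)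
    omega
  · have := hmin p (Finset.mem_filter.2 ⟨hp, by omega, by omega⟩)
    omega

lemma exists_vertEdge_up {q : Pt} (hY : Y ⊆ grid n) (hq : q ∈ Y) :
    ∃ t ∈ vertEdges n Y, t.1 = q := by
  have hg := mem_grid.1 (hY hq)
  obtain ⟨t, ht, h1, h2, h3⟩ := exists_vertEdge (Y := Y) hg.1 hg.2.2
  refine ⟨t, ht, ?_⟩
  obtain ⟨-, hv, -, h⟩ := mem_vertEdges.1 ht
  have hv1 := hv.1
  rcases h q (Finset.mem_union_left _ hq) ⟨by omega, by omega, by omega, by omega⟩ with h | h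
  · exact h.symm
  · rw [h] at h3; omega

lemma exists_vertEdge_down {q : Pt} (hY : Y ⊆ grid n) (hq : q ∈ Y) :
    ∃ t ∈ vertEdges n Y, t.2 = q := by
  have hg := mem_grid.1 (hY hq)
  obtain ⟨t, ht, h1, h2, h3⟩ := exists_vertEdge (Y := Y) (y := q.2 - 1) hg.1 (by omega)
  refine ⟨t, ht, ?_⟩
  obtain ⟨-, hv, -, h⟩ := mem_vertEdges.1 ht
  have hv1 := hv.1
  rcases h q (Finset.mem_union_left _ hq) ⟨by omega, by omega, by omega, by omega⟩ with h | h
  · have := congrArg Prod.snd h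
    omega
  · exact h.symm

lemma exists_horEdge_right {q : Pt} (hY : Y ⊆ grid n) (hq : q ∈ Y) :
    ∃ t ∈ horEdges n Y, t.1 = q := by
  have hg := mem_grid.1 (hY hq)
  obtain ⟨t, ht, h1, h2, h3⟩ := exists_horEdge (Y := Y) hg.1.2 hg.2
  refine ⟨t, ht, ?_⟩
  obtain ⟨-, hv, -, h⟩ := mem_horEdges.1 ht
  have hv1 := hv.1
  rcases h q (Finset.mem_union_left _ hq) ⟨by omega, by omega, by omega, by omega⟩ with h | h
  · exact h.symm
  · rw [h] at h3; omega

lemma exists_horEdge_left {q : Pt} (hY : Y ⊆ grid n) (hq : q ∈ Y) :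
    ∃ t ∈ horEdges n Y, t.2 = q := by
  have hg := mem_grid.1 (hY hq)
  obtain ⟨t, ht, h1, h2, h3⟩ := exists_horEdge (Y := Y) (x := q.1 - 1) (by omega) hg.2
  refine ⟨t, ht, ?_⟩
  obtain ⟨-, hv, -, h⟩ := mem_horEdges.1 ht
  have hv1 := hv.1
  rcases h q (Finset.mem_union_left _ hq) ⟨by omega, by omega, by omega, by omega⟩ with h | h
  · have := congrArg Prod.fst h
    omega
  · exact h.symm

lemma exists_upEdge_horEdges {q : Pt} (hY : Y ⊆ grid n) (hq : q ∈ Y) :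
    (∃ w, UpEdge s (horEdges n Y) q w) ∧ ∃ w, UpEdge s (horEdges n Y) w q := by
  obtain ⟨t, ht, rfl⟩ := exists_horEdge_right hY hq
  obtain ⟨u, hu, hut⟩ := exists_horEdge_left hY hq
  have h1 := (mem_horEdges.1 ht).2.1
  have h2 := (mem_horEdges.1 hu).2.1
  rw [← hut]
  cases s
  · exact ⟨hut ▸ ⟨_, .of_isHor_plus ht h1⟩, ⟨_, .of_isHor_plus hu h2⟩⟩
  · exact ⟨⟨_, .of_isHor_minus hu h2⟩, hut ▸ ⟨_, .of_isHor_minus ht h1⟩⟩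

/-- The vertical segment `v` and the horizontal segment `h` cross in their interiors. -/
def Crosses (v h : Seg) : Prop :=
  (h.1.1 < v.1.1 ∧ v.1.1 < h.2.1) ∧ v.1.2 < h.1.2 ∧ h.1.2 < v.2.2

/-- Two staircase steps that enter and leave `q` do not form an elbow of the sign of the
staircase. -/
lemma not_formsElbow {u q w : Pt} (huq : Forward s u q) (hqw : Forward s q w) {v h : Seg}
    (hv : v = segOf u q ∨ v = segOf q w) (hh : h = segOf u q ∨ h = segOf q w) :
    ¬ FormsElbow s q v h := by
  obtain ⟨u1, u2⟩ := u
  obtain ⟨q1, q2⟩ := q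
  obtain ⟨w1, w2⟩ := w
  rintro ⟨⟨h1, h2⟩, ⟨h3, h4⟩, h5⟩
  unfold segOf at hv hh
  cases s <;> simp only [Forward, Sgn.coord] at huq hqw <;>
    rcases hv with rfl | rfl <;> rcases hh with rfl | rfl <;> split_ifs at * <;>
    simp only [Prod.mk.injEq] at * <;> omega

/-- A state whose segments join consecutive points is valid if no two segments cross and staircase
paths can be continued in both directions at all points. -/
lemma valid_of_forall_exists_upEdge (hY : Y ⊆ grid n) {S : RState} (hP : S.P = Y ∪ margin n)
    (hL : S.L ⊆ vertEdges n Y ∪ horEdges n Y)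
    (hc : ∀ v ∈ S.L, ∀ h ∈ S.L, v ∈ vertEdges n Y → h ∈ horEdges n Y → ¬ Crosses v h)
    (hup : ∀ q ∈ Y, (∃ w, UpEdge e.opp S.L q w) ∧ ∃ u, UpEdge e.opp S.L u q) : S.Valid e n := by
  classical
  have hmem : ∀ t ∈ S.L, (t.1 ∈ Y ∪ margin n ∧ t.2 ∈ Y ∪ margin n) ∧ (t.IsHor ∨ t.IsVert) ∧
      ∀ p ∈ Y ∪ margin n, t.Contains p → t.IsEnd p := by
    intro t ht
    rcases Finset.mem_union.1 (hL ht) with h | h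
    · rw [mem_vertEdges] at h
      exact ⟨h.1, .inr h.2.1, h.2.2.2⟩
    · rw [mem_horEdges] at h
      exact ⟨h.1, .inl h.2.1, h.2.2.2⟩
  have hpar : ∀ t ∈ S.L, ∀ u ∈ S.L, t ≠ u → ∀ p, t.Contains p → u.Contains p →
      t.IsEnd p := by
    intro t ht u hu hne p hp hp'
    by_contra hend
    -- otherwise `p` is no point of the state, so it is not an endpoint of `u` either
    obtain ⟨⟨t1, t2⟩, t3, t4⟩ := hmem t ht
    obtain ⟨⟨u1, u2⟩, u3, u4⟩ := hmem u hu
    have hpP : p ∉ Y ∪ margin n := fun h => hend (t4 p h hp)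
    have hp1 : p ≠ t.1 := fun h => hpP (h ▸ t1)
    have hp2 : p ≠ t.2 := fun h => hpP (h ▸ t2)
    have hp3 : p ≠ u.1 := fun h => hpP (h ▸ u1)
    have hp4 : p ≠ u.2 := fun h => hpP (h ▸ u2)
    have e1 := t4 _ u1
    have e2 := t4 _ u2
    have e3 := u4 _ t1
    have e4 := u4 _ t2
    obtain ⟨⟨a, b⟩, ⟨c, d⟩⟩ := t
    obtain ⟨⟨a', b'⟩, ⟨c', d'⟩⟩ := u
    obtain ⟨x, y⟩ := p
    simp only [Seg.Contains, Seg.IsEnd, Prod.mk.injEq, ne_eq] at *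
    rcases Finset.mem_union.1 (hL ht) with h | h <;>
      rcases Finset.mem_union.1 (hL hu) with h' | h'
    · have k1 := (mem_vertEdges.1 h).2.1
      have k2 := (mem_vertEdges.1 h').2.1
      simp only [Seg.IsVert] at k1 k2
      clear hc hup hL hmem h h' t4 u4 t3 u3
      omega
    · have k1 := (mem_vertEdges.1 h).2.1
      have k2 := (mem_horEdges.1 h').2.1
      have k3 := hc _ ht _ hu h h'
      simp only [Seg.IsVert, Seg.IsHor, Crosses] at k1 k2 k3
      clear hc hup hL hmem h h' t4 u4 t3 u3 e1 e2 e3 e4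
      omega
    · have k1 := (mem_horEdges.1 h).2.1
      have k2 := (mem_vertEdges.1 h').2.1
      have k3 := hc _ hu _ ht h' h
      simp only [Seg.IsVert, Seg.IsHor, Crosses] at k1 k2 k3
      clear hc hup hL hmem h h' t4 u4 t3 u3 e1 e2 e3 e4
      omega
    · have k1 := (mem_horEdges.1 h).2.1
      have k2 := (mem_horEdges.1 h').2.1
      simp only [Seg.IsHor] at k1 k2
      clear hc hup hL hmem h h' t4 u4 t3 u3
      omega
  refine ⟨?_, ?_, ?_, ?_, ?_⟩
  · rw [hP]
    intro p hp
    exact mem_board ((Finset.mem_union.1 hp).imp (fun h => hY h) id)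
  · intro t ht
    rw [hP]
    exact ⟨(hmem t ht).2.1, (hmem t ht).1⟩
  · intro t ht p hp
    rw [hP] at hp
    exact (hmem t ht).2.2 p hp
  · exact fun t ht u hu hne p hp hp' => ⟨hpar t ht u hu hne p hp hp', hpar u hu t ht hne.symm p hp' hp⟩
  · intro q hq hqn
    have hqY : q ∈ Y := by
      rw [hP] at hq
      refine (Finset.mem_union.1 hq).resolve_right fun h => ?_
      rw [mem_margin] at h
      rw [mem_grid] at hqn
      omega
    obtain ⟨⟨w, hw⟩, u, hu⟩ := hup q hqY
    have hat : ∀ t, t ∈ S.at q ↔ t ∈ S.L ∧ t.Contains q := fun t => by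
      simp [RState.at]
    have b1 := hw.1.bounds
    have b2 := hu.1.bounds
    have m1 : segOf q w ∈ S.at q := (hat _).2 ⟨hw.2, hw.1.contains_segOf.2
      ⟨le_rfl, b1.1, le_rfl, b1.2⟩⟩
    have m2 : segOf u q ∈ S.at q := (hat _).2 ⟨hu.2, hu.1.contains_segOf.2
      ⟨b2.1, le_rfl, b2.2, le_rfl⟩⟩
    have hne : segOf u q ≠ segOf q w := by
      intro h
      have h1 : w = u ∨ w = q := isEnd_segOf.1 (h ▸ isEnd_segOf.2 (.inr rfl))
      have f1 := hw.1
      have f2 := hu.1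
      simp only [Forward] at f1 f2
      rcases h1 with rfl | rfl <;> omega
    have hsub : {segOf u q, segOf q w} ⊆ S.at q := by
      rw [Finset.insert_subset_iff, Finset.singleton_subset_iff]
      exact ⟨m2, m1⟩
    have hpair := Finset.card_pair hne
    refine ⟨hpair ▸ Finset.card_le_card hsub, fun h2 v hv h hh => ?_⟩
    have heq := Finset.eq_of_subset_of_card_le hsub (by omega)
    rw [← heq, Finset.mem_insert, Finset.mem_singleton] at hv hh
    exact not_formsElbow hu.1 hw.1 hv hh

/-- The state with the points `Y` and all vertical segments between consecutive points. -/
noncomputable def vertState (n : ℕ) (Y : Finset Pt) : RState where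
  P := Y ∪ margin n
  L := vertEdges n Y

lemma disjoint_vertEdges_horEdges {t : Seg} (h : t ∈ vertEdges n Y) (h' : t ∈ horEdges n Y) :
    False := by
  have h1 := (mem_vertEdges.1 h).2.1.1
  have h2 := (mem_horEdges.1 h').2.1.2
  omega

lemma valid_vertState (hY : Y ⊆ grid n) : (vertState n Y).Valid e n := by
  refine valid_of_forall_exists_upEdge hY rfl Finset.subset_union_left
    (fun v hv h hh _ hh' => (disjoint_vertEdges_horEdges hh hh').elim) fun q hq => ?_
  obtain ⟨t, ht, rfl⟩ := exists_vertEdge_up hY hq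
  obtain ⟨u, hu, hut⟩ := exists_vertEdge_down hY hq
  refine ⟨⟨t.2, UpEdge.of_isVert ht (mem_vertEdges.1 ht).2.1⟩, u.1, ?_⟩
  rw [← hut]
  exact UpEdge.of_isVert hu (mem_vertEdges.1 hu).2.1

lemma initialState_eq {σ : Equiv.Perm (Fin n)} : initialState σ = vertState n (pointSet σ) := by
  unfold initialState vertState
  congr 1
  ext t
  rw [mem_vertEdges, Finset.mem_biUnion]
  have hpt : ∀ p ∈ pointSet σ, ∀ q ∈ pointSet σ ∪ margin n, q.1 = p.1 →
      q = p ∨ q = (p.1, 0) ∨ q = (p.1, n + 1) := by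
    intro p hp q hq h
    rcases Finset.mem_union.1 hq with hq | hq
    · exact .inl (pointSet_ext_fst hq hp h)
    · have := mem_grid.1 (pointSet_subset_grid hp)
      rw [mem_margin] at hq
      simp only [Prod.ext_iff]
      omega
  constructor
  · rintro ⟨p, hp, ht⟩
    have hg := mem_grid.1 (pointSet_subset_grid hp)
    have m0 : (p.1, 0) ∈ pointSet σ ∪ margin n :=
      Finset.mem_union_right _ (mem_margin.2 (by simp; omega))
    have m1 : (p.1, n + 1) ∈ pointSet σ ∪ margin n :=
      Finset.mem_union_right _ (mem_margin.2 (by simp; omega))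
    rw [Finset.mem_insert, Finset.mem_singleton] at ht
    rcases ht with rfl | rfl
    · refine ⟨⟨m0, Finset.mem_union_left _ hp⟩, ⟨rfl, by simp only; omega⟩, hg.1, fun q hq hc => ?_⟩
      simp only [Seg.Contains] at hc
      rcases hpt p hp q hq (by omega) with rfl | rfl | rfl
      · exact .inr rfl
      · exact .inl rfl
      · simp only at hc; omega
    · refine ⟨⟨Finset.mem_union_left _ hp, m1⟩, ⟨rfl, by simp only; omega⟩, hg.1, fun q hq hc => ?_⟩
      simp only [Seg.Contains] at hc
      rcases hpt p hp q hq (by omega) with rfl | rfl | rfl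
      · exact .inl rfl
      · simp only at hc; omega
      · exact .inr rfl
  · rintro ⟨⟨h1, h2⟩, hv, hx, hno⟩
    obtain ⟨p, hp, hpx⟩ := exists_mem_pointSet_fst σ hx.1 hx.2
    have hg := mem_grid.1 (pointSet_subset_grid hp)
    have hv1 := hv.1
    have hv2 := hv.2
    have hend := hno p (Finset.mem_union_left _ hp)
    refine ⟨p, hp, ?_⟩
    rw [Finset.mem_insert, Finset.mem_singleton]
    obtain ⟨t1, t2⟩ := t
    simp only [Seg.Contains, Seg.IsEnd] at *
    rcases hpt p hp t1 h1 hpx.symm with e1 | e1 | e1 <;>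
      rcases hpt p hp t2 h2 (by omega) with e2 | e2 | e2 <;>
      simp only [Prod.ext_iff] at e1 e2 hend ⊢ <;> omega

/-- A vertical flip along a present vertical line subdivides this line at a new point `y`. -/
lemma step_vertState (hY : Y ⊆ grid n) {y : Pt} (hy : y ∈ grid n) (hyY : y ∉ Y) :
    Step e n (vertState n Y) (vertState n (insert y Y)) := by
  classical
  have hg := mem_grid.1 hy
  have hyM : y ∉ margin n := by rw [mem_margin]; omega
  obtain ⟨t, ht, h1, h2, h3⟩ := exists_vertEdge (Y := Y) hg.1 hg.2.2
  obtain ⟨⟨t1, t2⟩, hv, hx, hno⟩ := mem_vertEdges.1 ht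
  have hv1 := hv.1
  have hne : t.1 ≠ y := fun h => by
    rw [h, Finset.mem_union] at t1
    tauto
  have hlt : t.1.2 < y.2 := by
    refine lt_of_le_of_ne h2 fun h => hne (Prod.ext h1 h)
  have hins : ∀ p, p ∈ insert y Y ∪ margin n ↔ p = y ∨ p ∈ Y ∪ margin n := by
    intro p
    rw [Finset.insert_union, Finset.mem_insert]
  have hcut : ∀ u ∈ vertEdges n Y, u.InInterior y →
      (u.1, y) ∈ vertEdges n (insert y Y) ∧ (y, u.2) ∈ vertEdges n (insert y Y) := by
    intro u hu hi
    obtain ⟨⟨u1, u2⟩, hv, hx, hno⟩ := mem_vertEdges.1 hu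
    have hc := hi.1
    have hn1 : ¬ (u.1.1 = y.1 ∧ u.1.2 = y.2) := fun h => hi.2 (.inl (Prod.ext h.1 h.2).symm)
    have hn2 : ¬ (u.2.1 = y.1 ∧ u.2.2 = y.2) := fun h => hi.2 (.inr (Prod.ext h.1 h.2).symm)
    have hv1 := hv.1
    have hv2 := hv.2
    simp only [Seg.Contains] at hc hno
    constructor
    · refine mem_vertEdges.2 ⟨⟨(hins _).2 (.inr u1), (hins _).2 (.inl rfl)⟩,
        ⟨by simp only; omega, by simp only; omega⟩, hx, fun p hp hpc => ?_⟩
      simp only [Seg.Contains] at hpc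
      rcases (hins p).1 hp with rfl | hp
      · exact .inr rfl
      · rcases hno p hp (by omega) with h | h
        · exact .inl h
        · rw [h] at hpc
          omega
    · refine mem_vertEdges.2 ⟨⟨(hins _).2 (.inl rfl), (hins _).2 (.inr u2)⟩,
        ⟨by simp only; omega, by simp only; omega⟩, by simp only; omega, fun p hp hpc => ?_⟩
      simp only [Seg.Contains] at hpc
      rcases (hins p).1 hp with rfl | hp
      · exact .inl rfl
      · rcases hno p hp (by omega) with h | h
        · rw [h] at hpc
          omega
        · exact .inr h
  have hti : t.InInterior y := by
    refine ⟨⟨by omega, by omega, by omega, by omega⟩, ?_⟩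
    rintro (h | h)
    · exact hne h.symm
    · rw [← h] at h3
      omega
  have hP : (vertState n Y).P ∪ {t.1, y} = insert y Y ∪ margin n := by
    ext p
    rw [hins]
    simp only [vertState, Finset.mem_union, Finset.mem_insert, Finset.mem_singleton]
    rw [Finset.mem_union] at t1
    constructor
    · rintro (h | rfl | h)
      · exact .inr h
      · exact .inr t1
      · exact .inl h
    · tauto
  have hL : ((vertState n Y).flip t.1 y).L = vertEdges n (insert y Y) := by
    ext u
    rw [mem_flip]
    constructor
    · rintro (rfl | ⟨hu, -, hi⟩ | ⟨w, hw, hu⟩ | ⟨w, hw, hu⟩)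
      · exact (hcut t ht hti).1
      · obtain ⟨⟨u1, u2⟩, hv, hx, hno⟩ := mem_vertEdges.1 hu
        refine mem_vertEdges.2 ⟨⟨(hins _).2 (.inr u1), (hins _).2 (.inr u2)⟩, hv, hx,
          fun p hp hpc => ?_⟩
        rcases (hins p).1 hp with rfl | hp
        · by_contra h
          exact hi ⟨hpc, h⟩
        · exact hno p hp hpc
      · unfold Seg.cut at hu
        split_ifs at hu with hi
        · exact absurd ((mem_vertEdges.1 hw).2.2.2 _ t1 hi.1) hi.2
        · simp at hu
      · unfold Seg.cut at hu
        split_ifs at hu with hi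
        · have := hcut w hw hi
          rw [Finset.mem_insert, Finset.mem_singleton] at hu
          rcases hu with rfl | rfl
          exacts [this.1, this.2]
        · simp at hu
    · intro hu
      obtain ⟨⟨u1, u2⟩, huv, hux, huno⟩ := mem_vertEdges.1 hu
      have huv1 := huv.1
      have huv2 := huv.2
      rcases (hins _).1 u1 with e1 | u1'
      · -- the part above `y`
        have h5 := huno t.2 ((hins _).2 (.inr t2))
        have h6 := hno u.2 (((hins _).1 u2).resolve_left fun h => by rw [e1, h] at huv2; omega)
        simp only [Seg.Contains, Seg.IsEnd] at h5 h6
        have e1' := congrArg Prod.fst e1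
        have e1'' := congrArg Prod.snd e1
        have h7 : u.2 = t.2 := by
          by_cases hle : t.2.2 ≤ u.2.2
          · rcases h5 (by omega) with h | h
            · rw [h] at h3; omega
            · exact h.symm
          · rcases h6 (by omega) with h | h
            · rw [h] at huv2; omega
            · exact h
        refine .inr (.inr (.inr ⟨t, ht, ?_⟩))
        rw [Seg.cut, if_pos hti, Finset.mem_insert, Finset.mem_singleton]
        exact .inr (Prod.ext e1 h7)
      rcases (hins _).1 u2 with e2 | u2'
      · -- the part below `y`
        have h5 := huno t.1 ((hins _).2 (.inr t1))
        have h6 := hno u.1 u1'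
        simp only [Seg.Contains, Seg.IsEnd] at h5 h6
        have e2' := congrArg Prod.fst e2
        have e2'' := congrArg Prod.snd e2
        have h7 : u.1 = t.1 := by
          by_cases hle : u.1.2 ≤ t.1.2
          · rcases h5 (by omega) with h | h
            · exact h.symm
            · exact absurd (h.trans e2) hne
          · rcases h6 (by omega) with h | h
            · exact h
            · rw [h] at huv2; omega
        exact .inl (Prod.ext h7 e2)
      · refine .inr (.inl ⟨mem_vertEdges.2 ⟨⟨u1', u2'⟩, huv, hux,
          fun p hp => huno p ((hins p).2 (.inr hp))⟩, ?_, ?_⟩)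
        · exact fun h => h.2 (huno _ ((hins _).2 (.inr t1)) h.1)
        · exact fun h => h.2 (huno _ ((hins _).2 (.inl rfl)) h.1)
  have hfl : (vertState n Y).flip t.1 y = vertState n (insert y Y) := by
    have : ∀ S T : RState, S.P = T.P → S.L = T.L → S = T := by
      rintro ⟨_, _⟩ ⟨_, _⟩ rfl rfl
      rfl
    exact this _ _ hP hL
  have hvalid : (vertState n (insert y Y)).Valid e n :=
    valid_vertState (Finset.insert_subset hy hY)
  refine ⟨t.1, mem_board ((Finset.mem_union.1 t1).imp (fun h => hY h) id), y, mem_board (.inl hy),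
    .inr ⟨h1, hlt⟩, ?_, ?_, ?_, hvalid⟩ <;> rw [hfl]
  exact hvalid

lemma flipsTo_vertState {σ : Equiv.Perm (Fin n)} (hXY : pointSet σ ⊆ Y) (hY : Y ⊆ grid n) :
    FlipsTo e n (initialState σ) (Y \ pointSet σ).card (vertState n Y) := by
  classical
  suffices ∀ D : Finset Pt, D ⊆ Y \ pointSet σ →
      FlipsTo e n (initialState σ) D.card (vertState n (D ∪ pointSet σ)) by
    have := this _ subset_rfl
    rwa [Finset.sdiff_union_of_subset hXY] at this
  intro D
  induction D using Finset.induction_on with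
  | empty =>
    intro _
    rw [Finset.empty_union, ← initialState_eq]
    exact .refl
  | insert y D hyD ih =>
    intro hD
    rw [Finset.insert_subset_iff, Finset.mem_sdiff] at hD
    rw [Finset.card_insert_of_notMem hyD, Finset.insert_union]
    refine (ih hD.2).step (step_vertState ?_ (hY hD.1.1) ?_)
    · exact Finset.union_subset (hD.2.trans (Finset.sdiff_subset.trans hY)) (hXY.trans hY)
    · rw [Finset.mem_union]
      exact fun h => h.elim hyD hD.1.2

open scoped Classical in
/-- The vertical segments that have to be kept as long as only the horizontal segments in `H` are
present: those with an endpoint at which staircase paths need them. -/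
noncomputable def keptEdges (s : Sgn) (n : ℕ) (Y : Finset Pt) (H : Finset Seg) : Finset Seg :=
  (vertEdges n Y).filter fun v =>
    ¬ ((v.1 ∈ Y → ∃ w, UpEdge s H v.1 w) ∧ (v.2 ∈ Y → ∃ w, UpEdge s H w v.2))

lemma mem_keptEdges {H : Finset Seg} {v : Seg} : v ∈ keptEdges s n Y H ↔ v ∈ vertEdges n Y ∧
    ¬ ((v.1 ∈ Y → ∃ w, UpEdge s H v.1 w) ∧ (v.2 ∈ Y → ∃ w, UpEdge s H w v.2)) := by
  classical
  rw [keptEdges, Finset.mem_filter]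

lemma UpEdge.mono {L L' : Finset Seg} (hL : L ⊆ L') {u v : Pt} (h : UpEdge s L u v) :
    UpEdge s L' u v := ⟨h.1, hL h.2⟩

lemma keptEdges_anti {H H' : Finset Seg} (hH : H ⊆ H') :
    keptEdges s n Y H' ⊆ keptEdges s n Y H := by
  intro v hv
  rw [mem_keptEdges] at hv ⊢
  refine ⟨hv.1, fun h => hv.2 ⟨fun h1 => ?_, fun h1 => ?_⟩⟩
  · obtain ⟨w, hw⟩ := h.1 h1
    exact ⟨w, hw.mono hH⟩
  · obtain ⟨w, hw⟩ := h.2 h1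
    exact ⟨w, hw.mono hH⟩

lemma exists_upEdge_kept (hY : Y ⊆ grid n) {H : Finset Seg} {q : Pt} (hq : q ∈ Y) :
    (∃ w, UpEdge s (keptEdges s n Y H ∪ H) q w) ∧ ∃ u, UpEdge s (keptEdges s n Y H ∪ H) u q := by
  obtain ⟨t, ht, rfl⟩ := exists_vertEdge_up hY hq
  obtain ⟨u, hu, hut⟩ := exists_vertEdge_down hY hq
  constructor
  · by_cases h : t ∈ keptEdges s n Y H
    · exact ⟨_, .of_isVert (Finset.mem_union_left _ h) (mem_vertEdges.1 ht).2.1⟩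
    · rw [mem_keptEdges, not_and, not_not] at h
      obtain ⟨w, hw⟩ := (h ht).1 hq
      exact ⟨w, hw.mono Finset.subset_union_right⟩
  · rw [← hut] at hq ⊢
    by_cases h : u ∈ keptEdges s n Y H
    · exact ⟨_, .of_isVert (Finset.mem_union_left _ h) (mem_vertEdges.1 hu).2.1⟩
    · rw [mem_keptEdges, not_and, not_not] at h
      obtain ⟨w, hw⟩ := (h hu).2 hq
      exact ⟨w, hw.mono Finset.subset_union_right⟩

/-- In a satisfied set, every vertical segment that crosses the horizontal segment leading away from
the lower endpoint of `v` reaches at least as high as `v`: a staircase path from the lower endpoint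
of `v` to the upper endpoint of the other segment has to start along `v`. -/
lemma length_lt_of_crosses_lower (hY : Y ⊆ grid n) (hsat : SignedSatisfied s Y) {u v : Seg}
    (hu : u ∈ vertEdges n Y) (hv : v ∈ vertEdges n Y) (hvY : v.1 ∈ Y) {w : Pt}
    (hw : UpEdge s (horEdges n Y) v.1 w) (hc : Crosses u (segOf v.1 w)) :
    v.2.2 - v.1.2 < u.2.2 - u.1.2 := by
  obtain ⟨⟨u1, u2⟩, huv, hux, -⟩ := mem_vertEdges.1 hu
  obtain ⟨⟨v1, v2⟩, hvv, hvx, hvno⟩ := mem_vertEdges.1 hv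
  obtain ⟨-, hhor, -, hhno⟩ := mem_horEdges.1 hw.2
  have hvn := (snd_le_of_mem hY v2).2
  have huv1 := huv.1
  have hvv1 := hvv.1
  have hvv2 := hvv.2
  have hrow : w.2 = v.1.2 := by
    have := hhor.1
    unfold segOf at this
    split_ifs at this
    exacts [this.symm, this]
  have hvw : s.coord v.1.1 < s.coord w.1 := by
    rcases hw.1 with h | h
    · omega
    · exact h.1
  have hc' : s.coord v.1.1 < s.coord u.1.1 ∧ s.coord u.1.1 < s.coord w.1 ∧
      u.1.2 < v.1.2 ∧ v.1.2 < u.2.2 := by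
    clear hhno hhor hsat hvno
    unfold Crosses segOf at hc
    cases s <;> simp only [Sgn.coord] at * <;> split_ifs at hc <;> simp only at hc <;> omega
  suffices v.2.2 ≤ u.2.2 by omega
  rcases Finset.mem_union.1 u2 with huY | huM
  · have hpath := hsat.mPath hvY huY (by rw [← huv1]; omega) (by omega)
    rcases Relation.ReflTransGen.cases_head hpath with h | ⟨c, hc1, hc2⟩
    · rw [h] at hc'; omega
    · have hb := MPath.bounds hc2
      rcases hc1.2.2 with ⟨k1, k2⟩ | ⟨k1, k2⟩
      · by_contra hlt
        rcases hvno c (Finset.mem_union_left _ hc1.2.1) ⟨by omega, by omega, by omega, by omega⟩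
          with h | h <;> rw [h] at hb k2 <;> omega
      · have hend := hhno c (Finset.mem_union_left _ hc1.2.1) (hw.1.contains_segOf.2
          ⟨k1.le, by rw [← huv1] at hb; omega, by omega, by omega⟩)
        rw [isEnd_segOf] at hend
        rw [← huv1] at hb
        rcases hend with rfl | rfl <;> omega
  · rw [mem_margin] at huM
    omega

/-- The mirror image of the preceding lemma. -/
lemma length_lt_of_crosses_upper (hY : Y ⊆ grid n) (hsat : SignedSatisfied s Y) {u v : Seg}
    (hu : u ∈ vertEdges n Y) (hv : v ∈ vertEdges n Y) (hvY : v.2 ∈ Y) {w : Pt}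
    (hw : UpEdge s (horEdges n Y) w v.2) (hc : Crosses u (segOf w v.2)) :
    v.2.2 - v.1.2 < u.2.2 - u.1.2 := by
  obtain ⟨⟨u1, u2⟩, huv, hux, -⟩ := mem_vertEdges.1 hu
  obtain ⟨⟨v1, v2⟩, hvv, hvx, hvno⟩ := mem_vertEdges.1 hv
  obtain ⟨-, hhor, -, hhno⟩ := mem_horEdges.1 hw.2
  have hvn := (snd_le_of_mem hY v2).2
  have huv1 := huv.1
  have hvv1 := hvv.1
  have hvv2 := hvv.2
  have hrow : w.2 = v.2.2 := by
    have := hhor.1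
    unfold segOf at this
    split_ifs at this
    exacts [this, this.symm]
  have hvw : s.coord w.1 < s.coord v.2.1 := by
    rcases hw.1 with h | h
    · omega
    · exact h.1
  have hc' : s.coord u.1.1 < s.coord v.2.1 ∧ s.coord w.1 < s.coord u.1.1 ∧
      u.1.2 < v.2.2 ∧ v.2.2 < u.2.2 := by
    clear hhno hhor hsat hvno
    unfold Crosses segOf at hc
    cases s <;> simp only [Sgn.coord] at * <;> split_ifs at hc <;> simp only at hc <;> omega
  suffices u.1.2 ≤ v.1.2 by omega
  rcases Finset.mem_union.1 u1 with huY | huM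
  · have hpath := hsat.mPath huY hvY (by omega) (by omega)
    rcases Relation.ReflTransGen.cases_tail hpath with h | ⟨c, hc1, hc2⟩
    · rw [← h] at hc'; omega
    · have hb := MPath.bounds hc1
      rcases hc2.2.2 with ⟨k1, k2⟩ | ⟨k1, k2⟩
      · by_contra hlt
        rcases hvno c (Finset.mem_union_left _ hc2.1) ⟨by omega, by omega, by omega, by omega⟩
          with h | h <;> rw [h] at hb k2 <;> omega
      · have hend := hhno c (Finset.mem_union_left _ hc2.1) (hw.1.contains_segOf.2
          ⟨by omega, k1.le, by omega, by omega⟩)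
        rw [isEnd_segOf] at hend
        rcases hend with rfl | rfl <;> omega
  · rw [mem_margin] at huM
    omega

/-- As long as horizontal segments are missing, one of them can be added without crossing a kept
vertical segment: a horizontal segment for whose sake a longest kept vertical segment is kept is
crossed by longer vertical segments only. -/
lemma exists_addable (hY : Y ⊆ grid n) (hsat : SignedSatisfied s Y) {H : Finset Seg}
    (hH : H ⊂ horEdges n Y) :
    ∃ h ∈ horEdges n Y, h ∉ H ∧ ∀ u ∈ keptEdges s n Y H, ¬ Crosses u h := by
  rcases (keptEdges s n Y H).eq_empty_or_nonempty with h0 | hne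
  · obtain ⟨h, h1, h2⟩ := Finset.exists_of_ssubset hH
    exact ⟨h, h1, h2, by simp [h0]⟩
  obtain ⟨v, hv, hmax⟩ := (keptEdges s n Y H).exists_max_image (fun v => v.2.2 - v.1.2) hne
  obtain ⟨hvE, hv'⟩ := mem_keptEdges.1 hv
  rw [not_and_or, Classical.not_imp, Classical.not_imp] at hv'
  rcases hv' with ⟨hvY, hno⟩ | ⟨hvY, hno⟩
  · obtain ⟨w, hw⟩ := (exists_upEdge_horEdges (s := s) hY hvY).1
    refine ⟨_, hw.2, fun h => hno ⟨w, hw.1, h⟩, fun u hu hc => ?_⟩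
    have := length_lt_of_crosses_lower hY hsat (mem_keptEdges.1 hu).1 hvE hvY hw hc
    have := hmax u hu
    omega
  · obtain ⟨w, hw⟩ := (exists_upEdge_horEdges (s := s) hY hvY).2
    refine ⟨_, hw.2, fun h => hno ⟨w, hw.1, h⟩, fun u hu hc => ?_⟩
    have := length_lt_of_crosses_upper hY hsat (mem_keptEdges.1 hu).1 hvE hvY hw hc
    have := hmax u hu
    omega

open scoped Classical in
/-- The state with the points `Y`, the horizontal segments `H` and the vertical segments that have to
be kept. -/
noncomputable def sweepState (s : Sgn) (n : ℕ) (Y : Finset Pt) (H : Finset Seg) : RState where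
  P := Y ∪ margin n
  L := keptEdges s n Y H ∪ H

lemma valid_of_keptEdges (hY : Y ⊆ grid n) {H H' : Finset Seg} (hH : H ⊆ H')
    (hH' : H' ⊆ horEdges n Y) {S : RState} (hP : S.P = Y ∪ margin n)
    (hL : ∀ t, t ∈ S.L ↔ t ∈ keptEdges e.opp n Y H ∨ t ∈ H')
    (hc : ∀ v ∈ keptEdges e.opp n Y H, ∀ h ∈ H', ¬ Crosses v h) : S.Valid e n := by
  classical
  refine valid_of_forall_exists_upEdge hY hP (fun t ht => ?_) (fun v hv h hh hvE hhE => ?_)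
    fun q hq => ?_
  · rcases (hL t).1 ht with h | h
    · exact Finset.mem_union_left _ (mem_keptEdges.1 h).1
    · exact Finset.mem_union_right _ (hH' h)
  · rcases (hL v).1 hv with hv | hv
    · rcases (hL h).1 hh with hh | hh
      · exact (disjoint_vertEdges_horEdges (mem_keptEdges.1 hh).1 hhE).elim
      · exact hc v hv h hh
    · exact (disjoint_vertEdges_horEdges hvE (hH' hv)).elim
  · have hsub : keptEdges e.opp n Y H ∪ H ⊆ S.L := by
      intro t ht
      exact (hL t).2 ((Finset.mem_union.1 ht).imp id fun h => hH h)
    obtain ⟨⟨w, hw⟩, u, hu⟩ := exists_upEdge_kept (s := e.opp) hY (H := H) hq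
    exact ⟨⟨w, hw.mono hsub⟩, u, hu.mono hsub⟩

lemma step_sweepState (hY : Y ⊆ grid n) {H : Finset Seg} (hH : H ⊆ horEdges n Y)
    (hc : ∀ v ∈ keptEdges e.opp n Y H, ∀ h ∈ H, ¬ Crosses v h) {h : Seg} (hh : h ∈ horEdges n Y)
    (hch : ∀ u ∈ keptEdges e.opp n Y H, ¬ Crosses u h) :
    Step e n (sweepState e.opp n Y H) (sweepState e.opp n Y (insert h H)) := by
  classical
  obtain ⟨⟨h1, h2⟩, hhor, -, -⟩ := mem_horEdges.1 hh
  have hsub : insert h H ⊆ horEdges n Y := Finset.insert_subset hh hH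
  have hc' : ∀ v ∈ keptEdges e.opp n Y H, ∀ g ∈ insert h H, ¬ Crosses v g := by
    intro v hv g hg
    rcases Finset.mem_insert.1 hg with rfl | hg
    exacts [hch v hv, hc v hv g hg]
  have hint : ∀ t ∈ (sweepState e.opp n Y H).L, ∀ p ∈ Y ∪ margin n, ¬ t.InInterior p := by
    intro t ht p hp hi
    rcases Finset.mem_union.1 ht with ht | ht
    · exact hi.2 ((mem_vertEdges.1 (mem_keptEdges.1 ht).1).2.2.2 p hp hi.1)
    · exact hi.2 ((mem_horEdges.1 (hH ht)).2.2.2 p hp hi.1)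
  have hP : ((sweepState e.opp n Y H).flip h.1 h.2).P = Y ∪ margin n := by
    refine Finset.union_eq_left.2 ?_
    rw [Finset.insert_subset_iff, Finset.singleton_subset_iff]
    exact ⟨h1, h2⟩
  have hL : ∀ t, t ∈ ((sweepState e.opp n Y H).flip h.1 h.2).L ↔
      t ∈ keptEdges e.opp n Y H ∨ t ∈ insert h H := by
    intro t
    have hcut : ∀ p ∈ Y ∪ margin n, ¬ ∃ u ∈ (sweepState e.opp n Y H).L, t ∈ Seg.cut p u := by
      rintro p hp ⟨u, hu, ht⟩
      rw [Seg.cut, if_neg (hint u hu p hp)] at ht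
      simp at ht
    rw [mem_flip, or_iff_left (hcut _ h2), or_iff_left (hcut _ h1), Finset.mem_insert]
    have : t ∈ (sweepState e.opp n Y H).L ↔ t ∈ keptEdges e.opp n Y H ∨ t ∈ H := Finset.mem_union
    constructor
    · rintro (rfl | ⟨h, -⟩)
      · exact .inr (.inl rfl)
      · exact (this.1 h).imp id .inr
    · rintro (h | rfl | h)
      · have ht := this.2 (.inl h)
        exact .inr ⟨ht, hint t ht _ h1, hint t ht _ h2⟩
      · exact .inl rfl
      · have ht := this.2 (.inr h)
        exact .inr ⟨ht, hint t ht _ h1, hint t ht _ h2⟩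
  have hb : ∀ p ∈ Y ∪ margin n, p ∈ board n := fun p hp =>
    mem_board ((Finset.mem_union.1 hp).imp (fun h => hY h) id)
  have hanti := keptEdges_anti (s := e.opp) (n := n) (Y := Y) (Finset.subset_insert h H)
  refine ⟨h.1, hb _ h1, h.2, hb _ h2, .inl hhor,
    valid_of_keptEdges hY (Finset.subset_insert h H) hsub hP hL hc', hP.symm, fun t ht => ?_,
    valid_of_keptEdges hY subset_rfl hsub rfl (fun t => Finset.mem_union)
      fun v hv => hc' v (hanti hv)⟩
  exact (hL t).2 ((Finset.mem_union.1 ht).imp (fun h => hanti h) id)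

lemma vertState_eq {σ : Equiv.Perm (Fin n)} (hXY : pointSet σ ⊆ Y) :
    vertState n Y = sweepState s n Y ∅ := by
  classical
  unfold vertState sweepState
  congr 1
  rw [Finset.union_empty]
  refine Finset.Subset.antisymm (fun v hv => mem_keptEdges.2 ⟨hv, ?_⟩)
    fun v hv => (mem_keptEdges.1 hv).1
  have hno : ∀ u w, ¬ UpEdge s ∅ u w := fun u w h => by simpa using h.2
  rintro ⟨h1, h2⟩
  have h1' : v.1 ∉ Y := fun h => by
    obtain ⟨w, hw⟩ := h1 h
    exact hno _ _ hw
  have h2' : v.2 ∉ Y := fun h => by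
    obtain ⟨w, hw⟩ := h2 h
    exact hno _ _ hw
  obtain ⟨⟨v1, v2⟩, hvv, hvx, hvno⟩ := mem_vertEdges.1 hv
  obtain ⟨p, hp, hpx⟩ := exists_mem_pointSet_fst σ hvx.1 hvx.2
  have hg := mem_grid.1 (pointSet_subset_grid hp)
  have m1 := mem_margin.1 ((Finset.mem_union.1 v1).resolve_left h1')
  have m2 := mem_margin.1 ((Finset.mem_union.1 v2).resolve_left h2')
  have hvv1 := hvv.1
  have hvv2 := hvv.2
  rcases hvno p (Finset.mem_union_left _ (hXY hp)) ⟨by omega, by omega, by omega, by omega⟩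
    with rfl | rfl
  · exact h1' (hXY hp)
  · exact h2' (hXY hp)

lemma card_horEdges_le (hY : Y ⊆ grid n) : (horEdges n Y).card ≤ Y.card + n := by
  classical
  have hmaps : ∀ t ∈ horEdges n Y, t.1 ∈ Y ∪ (Finset.Icc 1 n).image fun i => (0, i) := by
    intro t ht
    obtain ⟨⟨h1, h2⟩, hh, hy, -⟩ := mem_horEdges.1 ht
    rcases Finset.mem_union.1 h1 with h | h
    · exact Finset.mem_union_left _ h
    · have h3 := snd_le_of_mem hY h2
      have h4 := hh.2
      rw [mem_margin] at h
      refine Finset.mem_union_right _ (Finset.mem_image.2 ⟨t.1.2, Finset.mem_Icc.2 hy, ?_⟩)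
      exact Prod.ext (by simp only; omega) rfl
  have hinj : Set.InjOn Prod.fst (horEdges n Y : Set Seg) := by
    intro t ht u hu h
    obtain ⟨⟨-, t2⟩, ⟨th1, th2⟩, -, tno⟩ := mem_horEdges.1 ht
    obtain ⟨⟨-, u2⟩, ⟨uh1, uh2⟩, -, uno⟩ := mem_horEdges.1 hu
    rw [h] at th1 th2
    refine Prod.ext h ?_
    rcases le_total t.2.1 u.2.1 with hle | hle
    · rcases uno t.2 t2 ⟨by omega, by omega, by omega, by omega⟩ with h' | h'
      · rw [h'] at th2; omega
      · exact h'
    · rcases tno u.2 u2 ⟨by rw [h]; omega, by omega, by rw [h]; omega, by omega⟩ with h' | h'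
      · rw [h', h] at uh2; omega
      · exact h'.symm
  refine (Finset.card_le_card_of_injOn Prod.fst hmaps hinj).trans ((Finset.card_union_le _ _).trans ?_)
  refine Nat.add_le_add_left (Finset.card_image_le.trans ?_) _
  simp

/-- A satisfied superset yields a flip sequence: the points are put on the vertical lines, and then
the horizontal segments are added one after the other, while vertical segments are removed as soon as
possible. -/
lemma exists_mem_rectCosts_le {σ : Equiv.Perm (Fin n)} (hXY : pointSet σ ⊆ Y) (hY : Y ⊆ grid n)
    (hsat : SignedSatisfied e.opp Y) : ∃ k ∈ rectCosts e σ, k ≤ 2 * Y.card := by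
  classical
  have hseq : ∀ m ≤ (horEdges n Y).card, ∃ H ⊆ horEdges n Y, H.card = m ∧
      (∀ v ∈ keptEdges e.opp n Y H, ∀ h ∈ H, ¬ Crosses v h) ∧
      FlipsTo e n (initialState σ) ((Y \ pointSet σ).card + m) (sweepState e.opp n Y H) := by
    intro m
    induction m with
    | zero =>
      intro _
      refine ⟨∅, by simp, rfl, by simp, ?_⟩
      rw [← vertState_eq hXY]
      exact flipsTo_vertState hXY hY
    | succ m ih =>
      intro hm
      obtain ⟨H, hH, hcard, hc, hfl⟩ := ih (by omega)
      obtain ⟨h, hh, hhH, hch⟩ := exists_addable (s := e.opp) hY hsat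
        (Finset.ssubset_iff_subset_ne.2 ⟨hH, by rintro rfl; omega⟩)
      refine ⟨insert h H, Finset.insert_subset hh hH, by rw [Finset.card_insert_of_notMem hhH, hcard],
        fun v hv g hg => ?_, hfl.step (step_sweepState hY hH hc hh hch)⟩
      have hv' := keptEdges_anti (Finset.subset_insert h H) hv
      rcases Finset.mem_insert.1 hg with rfl | hg
      exacts [hch v hv', hc v hv' g hg]
  obtain ⟨H, hH, hcard, hc, hfl⟩ := hseq _ le_rfl
  obtain rfl := Finset.eq_of_subset_of_card_le hH hcard.ge
  have hkept : keptEdges e.opp n Y (horEdges n Y) = ∅ := by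
    refine Finset.eq_empty_of_forall_notMem fun v hv => (mem_keptEdges.1 hv).2 ⟨fun h => ?_, fun h => ?_⟩
    · exact (exists_upEdge_horEdges hY h).1
    · exact (exists_upEdge_horEdges hY h).2
  have hL : (sweepState e.opp n Y (horEdges n Y)).L = horEdges n Y := by
    simp [sweepState, hkept]
  refine ⟨_, ⟨_, hfl, ?_, ?_, ?_, ?_⟩, ?_⟩
  · exact valid_of_keptEdges hY subset_rfl subset_rfl rfl (fun t => Finset.mem_union) hc
  · exact Finset.union_subset_union hXY subset_rfl
  · rw [hL]
    exact fun t ht => (mem_horEdges.1 ht).2.1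
  · intro x hx y hy
    rw [Finset.mem_range] at hx
    rw [Finset.mem_Icc] at hy
    -- the point `(n + 1, y)` is the right end of the last segment of its row
    obtain ⟨t, ht, h1, h2, h3⟩ := exists_horEdge (Y := Y) (x := min x n) (min_le_right x n) hy
    have h4 := (mem_horEdges.1 ht).2.1.1
    rw [hL]
    exact ⟨t, ht, by simp only; omega, by simp only; omega, by simp only; omega,
      by simp only; omega⟩
  · have h1 := card_horEdges_le hY
    have h2 := Finset.card_sdiff_add_card_eq_card hXY
    rw [card_pointSet] at h2
    omega

end UpperBound

/-! ### Comparison of the five quantities -/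

section Comparison

variable {n : ℕ} (s : Sgn) (σ : Equiv.Perm (Fin n))

lemma card_greedy_mem_satCosts : (greedy s σ).card ∈ satCosts s σ :=
  ⟨_, pointSet_subset_greedy, greedy_subset_grid, signedSatisfied_greedy, rfl⟩

lemma card_greedy_le_signedGreedy : (greedy s σ).card ≤ signedGreedy σ := by
  cases s
  · exact Finset.card_le_card Finset.subset_union_left
  · exact Finset.card_le_card Finset.subset_union_right

lemma signedGreedy_le :
    signedGreedy σ ≤ 2 * (pointSet σ).card + 2 * maxIndep (pointSet σ) := by
  have h := Finset.card_union_le (greedy .plus σ) (greedy .minus σ)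
  have h1 := card_greedy_le (s := .plus) (σ := σ)
  have h2 := card_greedy_le (s := .minus) (σ := σ)
  have h3 := maxIndepSigned_le_maxIndep .plus (pointSet σ)
  have h4 := maxIndepSigned_le_maxIndep .minus (pointSet σ)
  unfold signedGreedy
  omega

lemma satCosts_subset : satCosts s σ ⊆ signedManhattanCosts s σ := by
  rintro k ⟨Y, hXY, -, hsat, rfl⟩
  exact card_mem_signedManhattanCosts σ hXY fun a ha b hb h =>
    hsat.mPath (hXY ha) (hXY hb) h.1.le h.2.le

lemma manhattanCosts_subset : manhattanCosts σ ⊆ signedManhattanCosts s σ := by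
  rintro k ⟨Y, hXY, hY, rfl⟩
  exact ⟨Y, hXY, fun a ha b hb _ => hY a ha b hb, rfl⟩

lemma signedGreedy_mem_manhattanCosts : signedGreedy σ ∈ manhattanCosts σ := by
  classical
  have hsub : ∀ s, greedy s σ ⊆ greedy .plus σ ∪ greedy .minus σ := fun s => by
    cases s
    exacts [Finset.subset_union_left, Finset.subset_union_right]
  have hXY : pointSet σ ⊆ greedy .plus σ ∪ greedy .minus σ :=
    pointSet_subset_greedy.trans (hsub .plus)
  have key : ∀ s, ∀ a ∈ pointSet σ, ∀ b ∈ pointSet σ, Oriented s a b → ∃ l, IsManhattanPath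
      ((greedy .plus σ ∪ greedy .minus σ).image toReal) (toReal a) (toReal b) l := fun s =>
    exists_isManhattanPath_of_oriented hXY fun a ha b hb h =>
      Relation.ReflTransGen.mono (fun u v huv => ⟨hsub s huv.1, hsub s huv.2.1, huv.2.2⟩) _ _
        (signedSatisfied_greedy.mPath (pointSet_subset_greedy ha) (pointSet_subset_greedy hb)
          h.1.le h.2.le)
  refine ⟨_, Finset.image_subset_image hXY, ?_,
    (Finset.card_image_of_injective _ toReal_injective).trans (by unfold signedGreedy; congr!)⟩
  rw [realPointSet_eq]
  intro a' ha' b' hb'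
  obtain ⟨a, ha, rfl⟩ := Finset.mem_image.1 ha'
  obtain ⟨b, hb, rfl⟩ := Finset.mem_image.1 hb'
  rcases lt_trichotomy a.1 b.1 with h1 | h1 | h1
  · rcases lt_trichotomy a.2 b.2 with h2 | h2 | h2
    · exact key .plus a ha b hb ⟨h1, h2⟩
    · exact absurd (congrArg Prod.fst (pointSet_ext_snd ha hb h2)) h1.ne
    · exact key .minus a ha b hb ⟨h1, h2⟩
  · obtain rfl := pointSet_ext_fst ha hb h1
    exact MPath.exists_isManhattanPath (s := .plus) (hXY ha) .refl
  · rcases lt_trichotomy a.2 b.2 with h2 | h2 | h2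
    · obtain ⟨l, hl⟩ := key .minus b hb a ha ⟨h1, h2⟩
      exact ⟨_, hl.reverse⟩
    · exact absurd (congrArg Prod.fst (pointSet_ext_snd ha hb h2)) h1.ne'
    · obtain ⟨l, hl⟩ := key .plus b hb a ha ⟨h1, h2⟩
      exact ⟨_, hl.reverse⟩

lemma satCosts_nonempty : (satCosts s σ).Nonempty := ⟨_, card_greedy_mem_satCosts s σ⟩

lemma signedManhattanCosts_nonempty : (signedManhattanCosts s σ).Nonempty :=
  (satCosts_nonempty s σ).mono (satCosts_subset s σ)

lemma manhattanCosts_nonempty : (manhattanCosts σ).Nonempty :=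
  ⟨_, signedGreedy_mem_manhattanCosts σ⟩

lemma exists_mem_rectCosts_le_signedGreedy : ∃ k ∈ rectCosts s σ, k ≤ 2 * signedGreedy σ := by
  obtain ⟨k, hk, h⟩ := exists_mem_rectCosts_le (e := s) pointSet_subset_greedy
    greedy_subset_grid (signedSatisfied_greedy (σ := σ))
  have := card_greedy_le_signedGreedy s.opp σ
  exact ⟨k, hk, by omega⟩

lemma rectCosts_nonempty : (rectCosts s σ).Nonempty :=
  (exists_mem_rectCosts_le_signedGreedy s σ).imp fun _ h => h.1

variable {σ} in
lemma MIR_le_of_forall {x : ℝ}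
    (h : ∀ s, (((pointSet σ).card + maxIndepSigned s (pointSet σ) : ℕ) : ℝ) ≤ x) :
    MIR (pointSet σ) ≤ x := by
  have h1 := h .plus
  have h2 := h .minus
  have h3 : (maxIndep (pointSet σ) : ℝ) ≤
      maxIndepSigned .plus (pointSet σ) + maxIndepSigned .minus (pointSet σ) := by
    exact_mod_cast maxIndep_le_add (pointSet σ)
  push_cast at h1 h2
  unfold MIR
  linarith

lemma MIR_le_optManhattan : MIR (pointSet σ) ≤ (optManhattan σ : ℝ) :=
  MIR_le_of_forall fun s => Nat.cast_le.2 (card_add_maxIndepSigned_le_of_mem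
    (manhattanCosts_subset s σ (Nat.sInf_mem (manhattanCosts_nonempty σ))))

lemma MIR_le_optSignedSat : MIR (pointSet σ) ≤ (optSignedSat σ : ℝ) := by
  refine MIR_le_of_forall fun s => Nat.cast_le.2 ?_
  have h := card_add_maxIndepSigned_le_of_mem
    (satCosts_subset s σ (Nat.sInf_mem (satCosts_nonempty s σ)))
  refine h.trans ?_
  cases s
  exacts [le_max_left _ _, le_max_right _ _]

lemma MIR_le_optSignedRect : MIR (pointSet σ) ≤ 7 * (optSignedRect σ : ℝ) := by
  refine MIR_le_of_forall fun s => ?_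
  obtain ⟨m, hm, hle⟩ := exists_mem_signedManhattanCosts_le
    (Nat.sInf_mem (rectCosts_nonempty s.opp σ))
  have hs : s.opp.opp = s := by cases s <;> rfl
  rw [hs] at hm
  have h1 := card_add_maxIndepSigned_le_of_mem hm
  have h2 : optRect s.opp σ ≤ optSignedRect σ := by
    cases s
    exacts [le_max_right _ _, le_max_left _ _]
  have h3 : optRect s.opp σ = sInf (rectCosts s.opp σ) := rfl
  have : (pointSet σ).card + maxIndepSigned s (pointSet σ) ≤ 7 * optSignedRect σ := by omega
  exact_mod_cast this

lemma optSignedSat_le_signedGreedy : optSignedSat σ ≤ signedGreedy σ :=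
  have h : ∀ s, optSat s σ ≤ signedGreedy σ := fun s =>
    (Nat.sInf_le (card_greedy_mem_satCosts s σ)).trans (card_greedy_le_signedGreedy s σ)
  max_le (h _) (h _)

lemma optSignedRect_le_signedGreedy : optSignedRect σ ≤ 2 * signedGreedy σ :=
  have h : ∀ s, optRect s σ ≤ 2 * signedGreedy σ := fun s => by
    obtain ⟨k, hk, hle⟩ := exists_mem_rectCosts_le_signedGreedy s σ
    exact (Nat.sInf_le hk).trans hle
  max_le (h _) (h _)

lemma optManhattan_le_signedGreedy : optManhattan σ ≤ signedGreedy σ :=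
  Nat.sInf_le (signedGreedy_mem_manhattanCosts σ)

variable {σ} in
/-- Each of the five quantities is within constant factors of the independent rectangle bound. -/
lemma MIR_le_and_le_MIR {A : ℝ} (hA : A ∈ quantities σ) :
    MIR (pointSet σ) ≤ 7 * A ∧ A ≤ 8 * MIR (pointSet σ) := by
  have hG : (signedGreedy σ : ℝ) ≤ 4 * MIR (pointSet σ) := by
    have : (signedGreedy σ : ℝ) ≤ 2 * (pointSet σ).card + 2 * maxIndep (pointSet σ) := by
      exact_mod_cast signedGreedy_le σ
    have h0 : (0 : ℝ) ≤ (pointSet σ).card := Nat.cast_nonneg _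
    unfold MIR
    linarith
  have h1 := MIR_le_optManhattan σ
  have h2 := MIR_le_optSignedSat σ
  have h3 := MIR_le_optSignedRect σ
  have h4 : (optSignedSat σ : ℝ) ≤ signedGreedy σ := by
    exact_mod_cast optSignedSat_le_signedGreedy σ
  have h5 : (optSignedRect σ : ℝ) ≤ 2 * signedGreedy σ := by
    exact_mod_cast optSignedRect_le_signedGreedy σ
  have h6 : (optManhattan σ : ℝ) ≤ signedGreedy σ := by
    exact_mod_cast optManhattan_le_signedGreedy σ
  have h0 : 0 ≤ MIR (pointSet σ) := by unfold MIR; positivity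
  simp only [quantities, Set.mem_insert_iff, Set.mem_singleton_iff] at hA
  rcases hA with rfl | rfl | rfl | rfl | rfl <;> constructor <;> linarith

end Comparison

/-- The five quantities agree up to an absolute constant factor (and the minimization problems in
their definitions have solutions); the signed manhattan optima are bounded below by the signed
independent rectangle bounds, and the manhattan optimum by `MIR`. -/
theorem theorem11 :
    (∃ C : ℝ, 0 < C ∧ ∀ (n : ℕ) (σ : Equiv.Perm (Fin n)),
      ∀ A ∈ quantities σ, ∀ B ∈ quantities σ, A ≤ C * B) ∧
    (∀ (n : ℕ) (σ : Equiv.Perm (Fin n)),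
      (∀ s : Sgn, (satCosts s σ).Nonempty ∧ (rectCosts s σ).Nonempty ∧
        (signedManhattanCosts s σ).Nonempty) ∧ (manhattanCosts σ).Nonempty) ∧
    (∀ (n : ℕ) (σ : Equiv.Perm (Fin n)) (s : Sgn),
      (pointSet σ).card + maxIndepSigned s (pointSet σ) ≤ optSignedManhattan s σ) ∧
    (∀ (n : ℕ) (σ : Equiv.Perm (Fin n)), MIR (pointSet σ) ≤ (optManhattan σ : ℝ)) := by
  refine ⟨⟨56, by norm_num, fun n σ A hA B hB => ?_⟩, fun n σ => ⟨fun s =>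
    ⟨satCosts_nonempty s σ, rectCosts_nonempty s σ, signedManhattanCosts_nonempty s σ⟩,
    manhattanCosts_nonempty σ⟩, fun n σ s => card_add_maxIndepSigned_le_of_mem
    (Nat.sInf_mem (signedManhattanCosts_nonempty s σ)), fun n σ => MIR_le_optManhattan σ⟩
  linarith [(MIR_le_and_le_MIR hA).2, (MIR_le_and_le_MIR hB).1]
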